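/- **Model.** Processors have distinct identifiers in $\mathbb N$. A sequence of updates starts from the empty graph $G_0$; the $i$-th update inserts an isolated vertex, deletes a vertex together with its incident edges, or inserts or deletes an edge, and turns $G_{i-1}$ into $G_i$. The arboricity of a graph is $\max_U\lceil |E(U)|/(|U|-1)\rceil$ over vertex sets $U$ with $|U|\ge 2$; the sequence is *arboricity-$\alpha$-preserving* if all $G_i$ have arboricity at most $\alpha$. After each update only the affected vertices wake up (the inserted or deleted vertex; the two endpoints of the inserted or deleted edge) and a deterministic update procedure runs in fault-free synchronous rounds until no processor is active and no message is in transit; then the next update takes place. In each round a processor sends at most one message to each neighbour (messages addressed to non-neighbours are lost, but counted); local computation is free. The procedure runs on $G_i$, except that a vertex that is to be deleted takes part in it and leaves, with its edges, when it is finished. The local memory of a processor consists of the identifiers of its out-neighbours and of further words; its size is the number of words. (It may still hold identifiers of former neighbours; these do not count as out-neighbours.) The algorithm maintains a $\Delta$-orientation if after each update procedure every edge of the current graph is listed as outgoing by exactly one endpoint and every vertex has at most $\Delta$ outgoing edges. **Theorem.** There are absolute constants $c, C$ such that for all integers $\alpha\ge 1$ and $\Delta\ge c\alpha$ there is a distributed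 algorithm with the following properties, for every $N$ and every arboricity-$\alpha$-preserving sequence of $t$ edge and vertex updates starting from the empty graph, with all identifiers smaller than $N$. 1. Every update procedure terminates, and the algorithm maintains a $\Delta$-orientation. 2. At all times, also during the update procedures, the local memory of every vertex has at most $C\Delta$ words. 3. ($\mathcal{CONGEST}$) Every message and every word of memory has at most $C\log_2 (N+2)$ bits. 4. (Optimal cost.) If $\delta\ge 0$ is any integer with $\Delta\ge c\delta$ and if the graphs $G_0,\dots,G_t$ have $\delta$-orientations (chosen with knowledge of the whole sequence) for which $f$ edge flips occur in total, then the total number of messages and the total number of rounds are each at most $C(t+f)$. 5. With $n_i$ the number of vertices of $G_i$, the total number of messages and the total number of rounds are each at most $C\sum_{i=1}^t\log_2(n_i+2)$. That is, the amortized message complexity and the amortized update time are $O(\log n)$. In particular, for $\Delta=O(\alpha)$ an $O(\alpha)$-orientation is maintained with $O(\log n)$ amortized update time and message complexity and with $O(\alpha)$ words of local memory. This memory is optimal: if $1\le\alpha$, $2\alpha\le N$, and a distributed algorithm in the above model maintains an orientation (with any outdegrees, at any cost) on all arboricity-$\alpha$-preserving sequences with identifiers smaller than $N$, then for some such sequence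 the memory of some vertex has at least $\alpha$ words at the end. -/

import Mathlib

/-! Dynamic distributed networks with bounded local memory, in the local wakeup model. -/

noncomputable section

namespace DynNet

/-! ### Dynamic graphs -/

/-- A finite undirected graph whose vertices are processors, named by identifiers in `ℕ`. -/
structure Network where
  /-- the processors that are present -/
  verts : Finset ℕ
  /-- the edges (communication links) -/
  links : Finset (Sym2 ℕ)

/-- The empty graph. -/
def Network.empty : Network := ⟨∅, ∅⟩

/-- Adjacency. -/
def Network.Adj (G : Network) (u v : ℕ) : Prop := s(u, v) ∈ G.links

instance (G : Network) (u v : ℕ) : Decidable (G.Adj u v) :=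
  inferInstanceAs (Decidable (s(u, v) ∈ G.links))

/-- `E(U)`: the edges with both endpoints in `U`. -/
def Network.linksIn (G : Network) (U : Finset ℕ) : Finset (Sym2 ℕ) := G.links ∩ U.sym2

/-- The arboricity `max_U ⌈|E(U)| / (|U| - 1)⌉`, over the vertex sets `U` with at least two elements
(it is `0` if there is no such `U`). -/
def Network.arboricity (G : Network) : ℕ :=
  (G.verts.powerset.filter fun U => 2 ≤ U.card).sup fun U =>
    ⌈((G.linksIn U).card : ℚ) / ((U.card : ℚ) - 1)⌉₊

/-- The updates available to the adversary. -/
inductive Update where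
  | insertVertex (v : ℕ)
  | deleteVertex (v : ℕ)
  | insertEdge (u v : ℕ)
  | deleteEdge (u v : ℕ)

/-- The updates that make sense in the graph `G`. -/
def Update.Legal (G : Network) : Update → Prop
  | .insertVertex v => v ∉ G.verts
  | .deleteVertex v => v ∈ G.verts
  | .insertEdge u v => u ∈ G.verts ∧ v ∈ G.verts ∧ u ≠ v ∧ ¬ G.Adj u v
  | .deleteEdge u v => G.Adj u v

/-- The graph after an update. A vertex is inserted without incident edges, and is deleted together
with all its incident edges. -/
def Network.apply (G : Network) : Update → Network
  | .insertVertex v => ⟨insert v G.verts, G.links⟩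
  | .deleteVertex v => ⟨G.verts.erase v, G.links.filter fun e => v ∉ e⟩
  | .insertEdge u v => ⟨G.verts, insert s(u, v) G.links⟩
  | .deleteEdge u v => ⟨G.verts, G.links.erase s(u, v)⟩

/-- The graph `G_i` after the first `i` updates of the sequence `σ` (so `σ i` leads from `G_i` to
`G_{i+1}`), starting with the empty graph. -/
def graphAt (σ : ℕ → Update) : ℕ → Network
  | 0 => Network.empty
  | i + 1 => (graphAt σ i).apply (σ i)

/-- The first `t` updates of `σ` are legal and keep the arboricity at most `α` at all times;
all identifiers in use are smaller than `N`. -/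
structure ArboricityPreserving (α N : ℕ) (σ : ℕ → Update) (t : ℕ) : Prop where
  legal : ∀ i < t, (σ i).Legal (graphAt σ i)
  arboricity_le : ∀ i ≤ t, (graphAt σ i).arboricity ≤ α
  id_lt : ∀ i ≤ t, ∀ v ∈ (graphAt σ i).verts, v < N

/-! ### Orientations -/

/-- `out v` lists the processors towards which `v` orients its edges. Every edge has to be oriented
by exactly one of its two endpoints; entries that are not current neighbours are meaningless. -/
def Orients (G : Network) (out : ℕ → Finset ℕ) : Prop :=
  ∀ u v, G.Adj u v → Xor (v ∈ out u) (u ∈ out v)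

/-- The number of edges of `G` that are oriented out of `v`. -/
def outdegree (G : Network) (out : ℕ → Finset ℕ) (v : ℕ) : ℕ :=
  ((out v).filter fun w => G.Adj v w).card

/-- A `d`-orientation of `G`: an orientation in which all outdegrees are at most `d`. -/
def IsOrientation (d : ℕ) (G : Network) (out : ℕ → Finset ℕ) : Prop :=
  Orients G out ∧ ∀ v ∈ G.verts, outdegree G out v ≤ d

/-- The number of edges that are present in both `G` and `G'` and that `out'` orients in `G'`
differently from `out` in `G` (each is counted once, at its tail with respect to `out`). -/
def flips (G G' : Network) (out out' : ℕ → Finset ℕ) : ℕ :=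
  ((G.verts ×ˢ G.verts).filter fun p =>
    G.Adj p.1 p.2 ∧ G'.Adj p.1 p.2 ∧ p.2 ∈ out p.1 ∧ p.2 ∉ out' p.1).card

/-- The total number of flips during the first `t` updates of `σ`, if the orientation after `i`
updates is `o i`. -/
def totalFlips (σ : ℕ → Update) (o : ℕ → ℕ → Finset ℕ) (t : ℕ) : ℕ :=
  ∑ i ∈ Finset.range t, flips (graphAt σ i) (graphAt σ (i + 1)) (o i) (o (i + 1))

/-! ### Distributed algorithms -/

/-- The local memory of a processor: the identifiers of its out-neighbours, which form its part of
the solution, and finitely many further words. -/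
structure Memory where
  out : Finset ℕ
  work : List ℕ

/-- Local memory usage, in words. -/
def Memory.size (m : Memory) : ℕ := m.out.card + m.work.length

/-- The memory of a newly inserted processor. -/
def Memory.blank : Memory := ⟨∅, []⟩

/-- All words in the memory have at most `b` bits. -/
def Memory.FitsIn (b : ℕ) (m : Memory) : Prop :=
  (∀ w ∈ m.out, Nat.size w ≤ b) ∧ ∀ x ∈ m.work, Nat.size x ≤ b

/-- What a processor affected by an update learns when it wakes up. -/
inductive Event where
  /-- it has just been inserted -/
  | born
  /-- it is about to be removed -/
  | leaving
  /-- an edge to the processor `w` has been inserted -/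
  | edgeInserted (w : ℕ)
  /-- the edge to the processor `w` has been deleted -/
  | edgeDeleted (w : ℕ)

/-- The messages that one processor sends or receives in one round: at most one per other processor.
The message exchanged with `w` is a positive number; the value `0` at `w` means no message. -/
abbrev Mail := ℕ →₀ ℕ

/-- A deterministic distributed algorithm. The first argument of each function is the identifier of
the processor that executes it; otherwise a processor only sees its own local memory and, in `wake`,
the update that woke it up, or, in `step`, the messages that it receives. A processor whose memory
is `active` also executes the rounds in which it receives no message. -/
structure Protocol where
  wake : ℕ → Memory → Event → Memory × Mail
  active : ℕ → Memory → Bool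
  step : ℕ → Memory → Mail → Memory × Mail

/-- The local memories of the processors, and the messages that they have just sent. -/
structure Config where
  mem : ℕ → Memory
  sent : ℕ → Mail

/-- The messages that `v` receives along the edges of `H`. Whatever a processor addresses to a
processor that is not its neighbour is lost. -/
def inbox (H : Network) (c : Config) (v : ℕ) : Mail :=
  Finsupp.onFinset H.verts (fun w => if w ∈ H.verts ∧ H.Adj w v then c.sent w v else 0) (by
    intro w hw
    by_contra hmem
    exact hw (if_neg fun h => hmem h.1))

open scoped Classical in
/-- What processor `v` does in one synchronous round on the network `H`. -/
def localStep (A : Protocol) (H : Network) (c : Config) (v : ℕ) : Memory × Mail :=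
  if v ∈ H.verts ∧ (A.active v (c.mem v) = true ∨ inbox H c v ≠ 0) then
    A.step v (c.mem v) (inbox H c v)
  else (c.mem v, 0)

/-- One synchronous round on the network `H`. -/
def syncRound (A : Protocol) (H : Network) (c : Config) : Config where
  mem := fun v => (localStep A H c v).1
  sent := fun v => (localStep A H c v).2

/-- The execution is over: no message is in transit and no processor is active. -/
def Quiet (A : Protocol) (H : Network) (c : Config) : Prop :=
  ∀ v ∈ H.verts, c.sent v = 0 ∧ A.active v (c.mem v) = false

/-- The number of messages that have just been sent (including those that will be lost). -/
def sentCount (H : Network) (c : Config) : ℕ := ∑ v ∈ H.verts, (c.sent v).support.card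

/-- Local wakeup: following an update to a vertex only this vertex wakes up, following an update to
an edge only its two endpoints do. -/
def Update.event : Update → ℕ → Option Event
  | .insertVertex v, x => if x = v then some .born else none
  | .deleteVertex v, x => if x = v then some .leaving else none
  | .insertEdge u v, x =>
      if x = u then some (.edgeInserted v) else if x = v then some (.edgeInserted u) else none
  | .deleteEdge u v, x =>
      if x = u then some (.edgeDeleted v) else if x = v then some (.edgeDeleted u) else none

/-- The network on which the update procedure runs: the graph after the update, except that a vertex
to be deleted takes part in the update procedure and retires with its edges only afterwards. -/
def duringUpdate (G : Network) : Update → Network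
  | .deleteVertex _ => G
  | e => G.apply e

/-- A newly inserted vertex starts with a blank memory. -/
def resetMem (mem : ℕ → Memory) : Update → ℕ → Memory
  | .insertVertex v => Function.update mem v Memory.blank
  | _ => mem

/-- What processor `x` does at the beginning of the update procedure. -/
def localWake (A : Protocol) (mem : ℕ → Memory) (e : Update) (x : ℕ) : Memory × Mail :=
  match e.event x with
  | some ev => A.wake x (resetMem mem e x) ev
  | none => (resetMem mem e x, 0)

/-- The configuration at the beginning of the update procedure. -/
def start (A : Protocol) (mem : ℕ → Memory) (e : Update) : Config where
  mem := fun x => (localWake A mem e x).1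
  sent := fun x => (localWake A mem e x).2

/-- The configuration `k` rounds after the update `e` of the graph `G`. -/
def configAfter (A : Protocol) (G : Network) (mem : ℕ → Memory) (e : Update) (k : ℕ) : Config :=
  (syncRound A (duringUpdate G e))^[k] (start A mem e)

/-- The number of rounds of the update procedure (meaningful only if it terminates). -/
def duration (A : Protocol) (G : Network) (mem : ℕ → Memory) (e : Update) : ℕ :=
  sInf {k | Quiet A (duringUpdate G e) (configAfter A G mem e k)}

/-- The local memories after the first `i` updates have been processed. -/
def memAt (A : Protocol) (σ : ℕ → Update) : ℕ → ℕ → Memory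
  | 0 => fun _ => Memory.blank
  | i + 1 => (configAfter A (graphAt σ i) (memAt A σ i) (σ i)
      (duration A (graphAt σ i) (memAt A σ i) (σ i))).mem

/-- The network on which the procedure for the update `σ i` runs. -/
def netDuring (σ : ℕ → Update) (i : ℕ) : Network := duringUpdate (graphAt σ i) (σ i)

/-- The configuration `k` rounds after the update `σ i`. -/
def configAt (A : Protocol) (σ : ℕ → Update) (i k : ℕ) : Config :=
  configAfter A (graphAt σ i) (memAt A σ i) (σ i) k

/-- The procedure for the update `σ i` comes to an end. -/
def TerminatesAt (A : Protocol) (σ : ℕ → Update) (i : ℕ) : Prop :=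
  ∃ k, Quiet A (netDuring σ i) (configAt A σ i k)

/-- The number of rounds used for the update `σ i`. -/
def roundsAt (A : Protocol) (σ : ℕ → Update) (i : ℕ) : ℕ :=
  duration A (graphAt σ i) (memAt A σ i) (σ i)

/-- The number of messages sent for the update `σ i`. -/
def messagesAt (A : Protocol) (σ : ℕ → Update) (i : ℕ) : ℕ :=
  ∑ k ∈ Finset.range (roundsAt A σ i), sentCount (netDuring σ i) (configAt A σ i k)

/-- The number of rounds used for the first `t` updates. -/
def totalRounds (A : Protocol) (σ : ℕ → Update) (t : ℕ) : ℕ :=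
  ∑ i ∈ Finset.range t, roundsAt A σ i

/-- The number of messages sent for the first `t` updates. -/
def totalMessages (A : Protocol) (σ : ℕ → Update) (t : ℕ) : ℕ :=
  ∑ i ∈ Finset.range t, messagesAt A σ i

/-- The orientation that the local memories describe after `i` updates. -/
def outAt (A : Protocol) (σ : ℕ → Update) (i v : ℕ) : Finset ℕ := (memAt A σ i v).out

/-- For the first `t` updates of `σ`, every update procedure terminates, and then the local memories
describe a `d`-orientation of the current graph. -/
def Maintains (A : Protocol) (d : ℕ) (σ : ℕ → Update) (t : ℕ) : Prop :=
  (∀ i < t, TerminatesAt A σ i) ∧ ∀ i ≤ t, IsOrientation d (graphAt σ i) (outAt A σ i)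

/-- During the first `t` updates, at all times, every processor uses at most `s` words of
memory. -/
def MemoryAtMost (A : Protocol) (s : ℕ) (σ : ℕ → Update) (t : ℕ) : Prop :=
  ∀ i < t, ∀ k, ∀ v ∈ (netDuring σ i).verts, ((configAt A σ i k).mem v).size ≤ s

/-- During the first `t` updates, every message and every word of memory has at most `b` bits. -/
def WordsAtMost (A : Protocol) (b : ℕ) (σ : ℕ → Update) (t : ℕ) : Prop :=
  ∀ i < t, ∀ k, ∀ v ∈ (netDuring σ i).verts,
    ((configAt A σ i k).mem v).FitsIn b ∧ ∀ w, Nat.size ((configAt A σ i k).sent v w) ≤ b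

end DynNet

end

noncomputable section

namespace DynNet

/-! ### Networks -/

/-! The algorithm is a local form of peeling, with threshold `T = 4 * α`. A vertex whose list of
out-neighbours exceeds `Δ` offers all its entries to the other endpoints. The load of a vertex is
the number of offers that it receives and makes. With load at most `T` it takes over every edge
offered to it and stops offering; with a larger load it rejects, and if it was offering itself it
offers again whatever was rejected. Outdated entries disappear on the way, since nobody rejects
them. If `U` is the set of overloaded vertices, then `4 * α * |U|` is at most the total load, hence
at most twice the number of offers, whereas `U` spans at most `α * |U|` links. So at most half of
the offers survive a phase of two rounds (`two_mul_sum_rejecters_le`).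

The cost is charged to an arbitrary reference `δ`-orientation `o` that the algorithm does not know.
A list entry is good if it is a link that `o` orients in the same way, and bad otherwise. An idle
vertex has potential `2 * bad`, an offering one `|out| + 2 * good + 2 * T`. A list longer than `Δ ≥
4 * δ + 2 * T` contains at most `δ` good entries, so starting to offer does not raise the potential
(`offering_le_idle`). Of the three terms, `|out|` pays for the offers, `2 * good` for good edges
that turn bad when they are reversed, and `2 * T` for the few entries kept by a vertex that stops
offering. In each phase the potential therefore falls by at least half the number of offers
(`potential_next_le`), which bounds both messages and rounds.

Between updates the potential is twice the number of bad entries. Deleting a vertex may turn many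
good entries bad at once, but each of them is matched by a vanishing link; hence `debt` also counts
the links, and it grows by at most 2 plus the number of reference flips per update
(`debt_wokenOut_le`). Summation gives the bound `C * (t + f)`.

For the logarithmic bound the reference is a `2 * α`-orientation. After the insertion of an edge, a
shortest directed path from the overfull vertex to one of outdegree below `2 * α` is reversed. As
long as all outdegrees are at least `2 * α`, sparsity makes the directed balls double, so the path
has at most `log₂ n` arcs (`exists_orientation_apply`).

The lower bound is averaging: the complete graph on `2 * α` vertices has arboricity at most `α` and
`α * (2 * α - 1)` edges, so some list has at least `α` entries. -/

/-- Every link joins two distinct processors that are present. -/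
def Network.WellFormed (G : Network) : Prop :=
  ∀ u v, G.Adj u v → u ∈ G.verts ∧ v ∈ G.verts ∧ u ≠ v

theorem Network.Adj.symm {G : Network} {u v : ℕ} (h : G.Adj u v) : G.Adj v u := by
  unfold Network.Adj at *
  rwa [Sym2.eq_swap]

theorem Network.WellFormed.apply {G : Network} (hG : G.WellFormed) {e : Update} (he : e.Legal G) :
    (G.apply e).WellFormed := by
  intro x y hxy
  cases e with
  | insertVertex v =>
    obtain ⟨h1, h2, h3⟩ := hG x y hxy
    exact ⟨Finset.mem_insert_of_mem h1, Finset.mem_insert_of_mem h2, h3⟩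
  | deleteVertex v =>
    simp only [Network.Adj, Network.apply, Finset.mem_filter, Sym2.mem_iff, not_or] at hxy
    obtain ⟨h1, h2, h3⟩ := hG x y hxy.1
    exact ⟨Finset.mem_erase.2 ⟨Ne.symm hxy.2.1, h1⟩, Finset.mem_erase.2 ⟨Ne.symm hxy.2.2, h2⟩, h3⟩
  | insertEdge u v =>
    simp only [Network.Adj, Network.apply, Finset.mem_insert] at hxy
    rcases hxy with h | h
    · obtain ⟨hu, hv, huv, -⟩ := he
      rcases Sym2.eq_iff.1 h with ⟨rfl, rfl⟩ | ⟨rfl, rfl⟩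
      · exact ⟨hu, hv, huv⟩
      · exact ⟨hv, hu, huv.symm⟩
    · exact hG x y h
  | deleteEdge u v =>
    simp only [Network.Adj, Network.apply, Finset.mem_erase] at hxy
    exact hG x y hxy.2

theorem wellFormed_graphAt {σ : ℕ → Update} {t : ℕ}
    (h : ∀ i < t, (σ i).Legal (graphAt σ i)) : ∀ i ≤ t, (graphAt σ i).WellFormed := by
  intro i
  induction i with
  | zero => intro _ u v huv; simp [graphAt, Network.empty, Network.Adj] at huv
  | succ i ih => intro hi; exact (ih (by omega)).apply (h i (by omega))

theorem Network.WellFormed.linksIn_eq_empty {G : Network} (hG : G.WellFormed) {U : Finset ℕ}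
    (hU : U.card ≤ 1) : G.linksIn U = ∅ := by
  rw [Finset.eq_empty_iff_forall_notMem]
  intro e
  induction e with
  | _ x y =>
    intro he
    simp only [Network.linksIn, Finset.mem_inter, Finset.mk_mem_sym2_iff] at he
    exact (hG x y he.1).2.2 (Finset.card_le_one.1 hU x he.2.1 y he.2.2)

/-- Sparsity of the induced subgraphs of a graph of bounded arboricity. -/
theorem card_linksIn_le {G : Network} (hG : G.WellFormed) {α : ℕ} (hα : G.arboricity ≤ α)
    {U : Finset ℕ} (hU : U ⊆ G.verts) : (G.linksIn U).card ≤ α * (U.card - 1) := by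
  by_cases h2 : 2 ≤ U.card
  · have h := (Finset.le_sup (f := fun U : Finset ℕ =>
      ⌈((G.linksIn U).card : ℚ) / ((U.card : ℚ) - 1)⌉₊)
      (Finset.mem_filter.2 ⟨Finset.mem_powerset.2 hU, h2⟩)).trans hα
    have h' := Nat.ceil_le.1 h
    have hc : (2 : ℚ) ≤ U.card := by exact_mod_cast h2
    rw [div_le_iff₀ (by linarith)] at h'
    have : ((G.linksIn U).card : ℚ) ≤ ((α * (U.card - 1) : ℕ) : ℚ) := by
      push_cast [Nat.cast_sub (show 1 ≤ U.card by omega)]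
      exact h'
    exact_mod_cast this
  · rw [hG.linksIn_eq_empty (by omega)]
    simp

/-- Directed pairs that contain each link of `G` at most once are no more than the links. -/
theorem card_le_card_links {P : Finset (ℕ × ℕ)} {L : Finset (Sym2 ℕ)}
    (h1 : ∀ p ∈ P, s(p.1, p.2) ∈ L) (h2 : ∀ p ∈ P, (p.2, p.1) ∉ P) : P.card ≤ L.card := by
  refine Finset.card_le_card_of_injOn (fun p => s(p.1, p.2)) h1 ?_
  rintro ⟨a, b⟩ hp ⟨c, d⟩ hq h
  rcases Sym2.eq_iff.1 h with ⟨h, h'⟩ | ⟨h, h'⟩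
  · simp only at h h'; rw [h, h']
  · simp only at h h'
    subst h h'
    exact absurd hq (h2 _ hp)

/-! ### Orientations with few flips -/

/-- An orientation that lists neighbours only. -/
structure Clean (G : Network) (out : ℕ → Finset ℕ) : Prop where
  orients : Orients G out
  adj : ∀ u v, v ∈ out u → G.Adj u v

theorem Clean.outdegree_eq {G : Network} {out : ℕ → Finset ℕ} (h : Clean G out) (v : ℕ) :
    outdegree G out v = (out v).card := by
  unfold outdegree
  rw [Finset.filter_true_of_mem fun w hw => h.adj v w hw]

/-- The vertices reachable from `u` in at most `k` steps. -/
def ball (out : ℕ → Finset ℕ) (u : ℕ) : ℕ → Finset ℕ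
  | 0 => {u}
  | k + 1 => ball out u k ∪ (ball out u k).biUnion out

theorem ball_mono (out : ℕ → Finset ℕ) (u : ℕ) : Monotone (ball out u) :=
  monotone_nat_of_le_succ fun _ => Finset.subset_union_left

theorem mem_ball_self (out : ℕ → Finset ℕ) (u k : ℕ) : u ∈ ball out u k :=
  ball_mono out u (Nat.zero_le k) (by simp [ball])

theorem ball_subset_verts {G : Network} (hG : G.WellFormed) {out : ℕ → Finset ℕ} (h : Clean G out)
    {u : ℕ} (hu : u ∈ G.verts) (k : ℕ) : ball out u k ⊆ G.verts := by
  induction k with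
  | zero => simpa [ball] using hu
  | succ k ih =>
    refine Finset.union_subset ih (Finset.biUnion_subset.2 fun x _ y hy => ?_)
    exact (hG x y (h.adj x y hy)).2.1

/-- As long as all outdegrees are at least `2 * α`, the balls double. -/
theorem two_mul_card_ball_le {G : Network} (hG : G.WellFormed) {α : ℕ} (hα : G.arboricity ≤ α)
    (hα1 : 1 ≤ α) {out : ℕ → Finset ℕ} (h : Clean G out) {u : ℕ} (hu : u ∈ G.verts) {k : ℕ}
    (hk : ∀ x ∈ ball out u k, 2 * α ≤ (out x).card) :
    2 * (ball out u k).card < (ball out u (k + 1)).card := by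
  have hle := card_linksIn_le hG hα (ball_subset_verts hG h hu (k + 1))
  have hpos : 0 < (ball out u (k + 1)).card := Finset.card_pos.2 ⟨u, mem_ball_self _ _ _⟩
  -- The arcs leaving the ball of radius `k` are distinct links inside the ball of radius `k + 1`,
  -- because only one endpoint lists a link.
  have hsum : (ball out u k).card * (2 * α) ≤ (G.linksIn (ball out u (k + 1))).card := by
    have h1 : (ball out u k).card * (2 * α) ≤ ∑ x ∈ ball out u k, (out x).card := by
      rw [← smul_eq_mul]
      exact Finset.card_nsmul_le_sum _ _ _ hk
    rw [← Finset.card_sigma] at h1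
    refine h1.trans ?_
    rw [← Finset.card_map (Equiv.sigmaEquivProd ℕ ℕ).toEmbedding]
    refine card_le_card_links ?_ ?_
    · rintro ⟨x, y⟩ hp
      simp only [Finset.mem_map_equiv, Finset.mem_sigma, Equiv.sigmaEquivProd_symm_apply] at hp
      simp only [Network.linksIn, Finset.mem_inter, Finset.mk_mem_sym2_iff]
      exact ⟨h.adj x y hp.2, ball_mono out u (Nat.le_succ k) hp.1,
        Finset.mem_union_right _ (Finset.mem_biUnion.2 ⟨x, hp.1, hp.2⟩)⟩
    · rintro ⟨x, y⟩ hp hq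
      simp only [Finset.mem_map_equiv, Finset.mem_sigma, Equiv.sigmaEquivProd_symm_apply] at hp hq
      rcases h.orients x y (h.adj x y hp.2) with hh | hh
      · exact hh.2 hq.2
      · exact hh.2 hp.2
  have h3 : α * (2 * (ball out u k).card) ≤ α * ((ball out u (k + 1)).card - 1) := by
    calc α * (2 * (ball out u k).card) = (ball out u k).card * (2 * α) := by ring
      _ ≤ _ := hsum.trans hle
  have := Nat.le_of_mul_le_mul_left h3 (by omega)
  omega

/-- Otherwise the balls around `u` would double until they outgrow the whole graph. -/
theorem exists_small_outdegree {G : Network} (hG : G.WellFormed) {α : ℕ} (hα : G.arboricity ≤ α)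
    (hα1 : 1 ≤ α) {out : ℕ → Finset ℕ} (h : Clean G out) {u : ℕ} (hu : u ∈ G.verts) :
    ∃ x ∈ ball out u (Nat.log 2 G.verts.card), (out x).card < 2 * α := by
  by_contra! hcon
  have key : ∀ k ≤ Nat.log 2 G.verts.card + 1, 2 ^ k ≤ (ball out u k).card := by
    intro k
    induction k with
    | zero => intro _; simp [ball]
    | succ k ih =>
      intro hk
      have h1 := ih (by omega)
      have h2 := two_mul_card_ball_le hG hα hα1 h hu (k := k)
        fun x hx => hcon x (ball_mono out u (by omega) hx)
      rw [pow_succ]; omega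
  have h1 := key _ le_rfl
  have h2 := Finset.card_le_card (ball_subset_verts hG h hu (Nat.log 2 G.verts.card + 1))
  have h3 := Nat.lt_pow_succ_log_self (b := 2) (by norm_num) G.verts.card
  omega

/-- Reverses the arc from `y` to `x`. -/
def reverseArc (out : ℕ → Finset ℕ) (y x : ℕ) : ℕ → Finset ℕ := fun z =>
  if z = y then (out y).erase x else if z = x then insert y (out x) else out z

theorem mem_reverseArc {out : ℕ → Finset ℕ} {y x z w : ℕ} (hxy : x ≠ y) :
    w ∈ reverseArc out y x z ↔ (w ∈ out z ∧ ¬ (z = y ∧ w = x)) ∨ (z = x ∧ w = y) := by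
  unfold reverseArc
  split_ifs with h1 h2
  · subst h1; simp [Finset.mem_erase]; grind
  · subst h2; simp; grind
  · grind

theorem Clean.reverseArc {G : Network} (hG : G.WellFormed) {out : ℕ → Finset ℕ} (h : Clean G out)
    {y x : ℕ} (hx : x ∈ out y) : Clean G (reverseArc out y x) := by
  have hyx := h.adj y x hx
  have hne := (hG y x hyx).2.2
  have hx' : y ∉ out x := by
    rcases h.orients y x hyx with hh | hh
    · exact hh.2
    · exact absurd hx hh.2
  constructor
  · intro a b hab
    have hh := h.orients a b hab
    rw [mem_reverseArc hne.symm, mem_reverseArc hne.symm]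
    unfold Xor at *
    grind
  · intro a b hb
    rw [mem_reverseArc hne.symm] at hb
    rcases hb with hb | ⟨rfl, rfl⟩
    · exact h.adj a b hb.1
    · exact hyx.symm

theorem flips_trans (G : Network) (o₁ o₂ o₃ : ℕ → Finset ℕ) :
    flips G G o₁ o₃ ≤ flips G G o₁ o₂ + flips G G o₂ o₃ := by
  unfold flips
  refine (Finset.card_le_card ?_).trans (Finset.card_union_le _ _)
  intro p hp
  simp only [Finset.mem_filter, Finset.mem_union] at *
  tauto

theorem flips_reverseArc_le (G : Network) (out : ℕ → Finset ℕ) {y x : ℕ} (hxy : x ≠ y) :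
    flips G G out (reverseArc out y x) ≤ 1 := by
  unfold flips
  rw [← Finset.card_singleton (y, x)]
  refine Finset.card_le_card fun p hp => ?_
  simp only [Finset.mem_filter, mem_reverseArc hxy] at hp
  simp only [Finset.mem_singleton, Prod.ext_iff]
  tauto

theorem flips_self (G G' : Network) (o : ℕ → Finset ℕ) : flips G G' o o = 0 := by
  unfold flips
  rw [Finset.card_eq_zero, Finset.filter_eq_empty_iff]
  tauto

/-- Reversing a shortest path from the only overfull vertex to a vertex that has room. -/
theorem exists_repair {G : Network} (hG : G.WellFormed) {d u : ℕ} (k : ℕ) :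
    ∀ out : ℕ → Finset ℕ, Clean G out → (out u).card ≤ d + 1 →
      (∀ v, v ≠ u → (out v).card ≤ d) → (∃ x ∈ ball out u k, (out x).card < d) →
      ∃ out', Clean G out' ∧ (∀ v, (out' v).card ≤ d) ∧ flips G G out out' ≤ k := by
  induction k with
  | zero =>
    rintro out h hu hv ⟨x, hx, hxd⟩
    simp only [ball, Finset.mem_singleton] at hx
    subst hx
    refine ⟨out, h, fun v => ?_, (flips_self _ _ _).le⟩
    by_cases hvx : v = x
    · subst hvx; omega
    · exact hv v hvx
  | succ k ih =>
    rintro out h hu hv ⟨x, hx, hxd⟩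
    by_cases hxk : x ∈ ball out u k
    · obtain ⟨o', h1, h2, h3⟩ := ih out h hu hv ⟨x, hxk, hxd⟩
      exact ⟨o', h1, h2, h3.trans (Nat.le_succ k)⟩
    obtain ⟨y, hy, hyx⟩ : ∃ y ∈ ball out u k, x ∈ out y := by
      simpa [ball, hxk] using hx
    have hne : x ≠ y := fun h => hxk (h ▸ hy)
    have hux : x ≠ u := fun h => hxk (h ▸ mem_ball_self _ _ _)
    have hc := h.reverseArc hG hyx
    have hcy : (reverseArc out y x y).card = (out y).card - 1 := by
      simp [reverseArc, Finset.card_erase_of_mem hyx]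
    have hcx : (reverseArc out y x x).card ≤ (out x).card + 1 := by
      simp only [reverseArc, if_neg hne, if_true]
      exact Finset.card_insert_le _ _
    have hcz : ∀ z, z ≠ y → z ≠ x → (reverseArc out y x z).card = (out z).card := by
      intro z h1 h2; simp [reverseArc, h1, h2]
    have hpos : 0 < (out y).card := Finset.card_pos.2 ⟨x, hyx⟩
    by_cases hyu : y = u
    · refine ⟨_, hc, fun v => ?_, (flips_reverseArc_le G out hne).trans (by omega)⟩
      by_cases h1 : v = y
      · subst h1; subst hyu; omega
      · by_cases h2 : v = x
        · subst h2; omega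
        · rw [hcz v h1 h2]; exact hv v (hyu ▸ h1)
    -- The reversed arc leads to `x`, outside the ball of radius `k`, so no ball of radius at most
    -- `k` shrinks. Having lost an arc, `y` now has room and replaces `x` at a radius smaller by
    -- one.
    · have hball : ∀ j ≤ k, ball out u j ⊆ ball (reverseArc out y x) u j := by
        intro j
        induction j with
        | zero => intro _; exact subset_rfl
        | succ j ihj =>
          intro hj
          refine Finset.union_subset ((ihj (by omega)).trans Finset.subset_union_left) ?_
          refine Finset.biUnion_subset.2 fun z hz w hw => ?_
          have hwx : w ≠ x := by
            rintro rfl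
            exact hxk (ball_mono out u hj
              (Finset.mem_union_right _ (Finset.mem_biUnion.2 ⟨z, hz, hw⟩)))
          refine Finset.mem_union_right _ (Finset.mem_biUnion.2 ⟨z, ihj (by omega) hz, ?_⟩)
          rw [mem_reverseArc hne]
          exact Or.inl ⟨hw, fun h => hwx h.2⟩
      obtain ⟨o', h1, h2, h3⟩ := ih (reverseArc out y x) hc
        (by rw [hcz u (Ne.symm hyu) hux.symm]; exact hu)
        (by
          intro v hvu
          by_cases h1 : v = y
          · subst h1; have := hv v hvu; omega
          · by_cases h2 : v = x
            · subst h2; omega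
            · rw [hcz v h1 h2]; exact hv v hvu)
        ⟨y, hball k le_rfl hy, by have := hv y hyu; omega⟩
      refine ⟨o', h1, h2, (flips_trans G out (DynNet.reverseArc out y x) o').trans ?_⟩
      have := flips_reverseArc_le G out hne
      omega

/-- A clean `2 * α`-orientation survives an update with logarithmically many flips. -/
theorem exists_orientation_apply {G : Network} (hG : G.WellFormed) {α : ℕ} (hα1 : 1 ≤ α)
    {e : Update} (he : e.Legal G) (hα : (G.apply e).arboricity ≤ α) {out : ℕ → Finset ℕ}
    (h : Clean G out) (hd : ∀ v, (out v).card ≤ 2 * α) :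
    ∃ out', Clean (G.apply e) out' ∧ (∀ v, (out' v).card ≤ 2 * α) ∧
      flips G (G.apply e) out out' ≤ Nat.log 2 (G.apply e).verts.card := by
  have hG' := hG.apply he
  cases e with
  | insertVertex v => exact ⟨out, ⟨h.orients, h.adj⟩, hd, by rw [flips_self]; exact Nat.zero_le _⟩
  | deleteVertex v =>
    refine ⟨fun u => (out u).filter fun w => (G.apply (.deleteVertex v)).Adj u w, ⟨?_, ?_⟩, ?_, ?_⟩
    · intro a b hab
      have := h.orients a b (Finset.mem_filter.1 hab).1
      simpa [hab, hab.symm] using this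
    · intro a b hb; exact (Finset.mem_filter.1 hb).2
    · intro a; exact (Finset.card_le_card (Finset.filter_subset _ _)).trans (hd a)
    · refine le_of_eq_of_le ?_ (Nat.zero_le _)
      unfold flips
      rw [Finset.card_eq_zero, Finset.filter_eq_empty_iff]
      simp only [Finset.mem_filter]
      tauto
  | deleteEdge u v =>
    refine ⟨fun x => (out x).filter fun w => (G.apply (.deleteEdge u v)).Adj x w, ⟨?_, ?_⟩, ?_, ?_⟩
    · intro a b hab
      have := h.orients a b (Finset.mem_erase.1 hab).2
      simpa [hab, hab.symm] using this
    · intro a b hb; exact (Finset.mem_filter.1 hb).2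
    · intro a; exact (Finset.card_le_card (Finset.filter_subset _ _)).trans (hd a)
    · refine le_of_eq_of_le ?_ (Nat.zero_le _)
      unfold flips
      rw [Finset.card_eq_zero, Finset.filter_eq_empty_iff]
      simp only [Finset.mem_filter]
      tauto
  | insertEdge u v =>
    obtain ⟨hu, hv, huv, hnew⟩ := he
    set G' := G.apply (.insertEdge u v) with hG'def
    have hadj : ∀ x y, G'.Adj x y ↔ (x = u ∧ y = v ∨ x = v ∧ y = u) ∨ G.Adj x y := by
      intro x y
      simp [G', Network.Adj, Network.apply]
    let o₁ : ℕ → Finset ℕ := fun x => if x = u then insert v (out u) else out x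
    have hmem : ∀ x y, y ∈ o₁ x ↔ (x = u ∧ y = v) ∨ y ∈ out x := by
      intro x y
      simp only [o₁]
      split_ifs with hx
      · subst hx; simp
      · simp [hx]
    have hc : Clean G' o₁ := by
      constructor
      · intro a b hab
        rw [hmem, hmem]
        have h1 := h.orients a b
        have h2 := h.adj a b
        have h3 := h.adj b a
        rw [hadj] at hab
        have h4 := hnew
        have h5 : ¬ G.Adj v u := fun hh => hnew hh.symm
        unfold Xor at *
        grind
      · intro a b hb
        rw [hmem] at hb
        rw [hadj]
        rcases hb with hb | hb
        · exact Or.inl (Or.inl hb)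
        · exact Or.inr (h.adj a b hb)
    obtain ⟨o', h1, h2, h3⟩ := exists_repair hG' (u := u) (d := 2 * α) _ o₁ hc
      (by simp only [o₁, if_true]
          exact (Finset.card_insert_le _ _).trans (Nat.succ_le_succ (hd u)))
      (by intro x hx; simp only [o₁, if_neg hx]; exact hd x)
      (exists_small_outdegree hG' hα hα1 hc hu)
    refine ⟨o', h1, h2, le_trans (Finset.card_le_card ?_) h3⟩
    intro p hp
    simp only [Finset.mem_filter] at hp ⊢
    refine ⟨hp.1, hp.2.2.1, hp.2.2.1, (hmem _ _).2 (Or.inr hp.2.2.2.1), hp.2.2.2.2⟩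

theorem exists_orientations {α N t : ℕ} {σ : ℕ → Update} (hα1 : 1 ≤ α)
    (hσ : ArboricityPreserving α N σ t) :
    ∃ o : ℕ → ℕ → Finset ℕ, (∀ i ≤ t, IsOrientation (2 * α) (graphAt σ i) (o i)) ∧
      totalFlips σ o t ≤ ∑ i ∈ Finset.range t, Nat.log 2 (graphAt σ (i + 1)).verts.card := by
  have hwf := wellFormed_graphAt hσ.legal
  have step : ∀ i (out : ℕ → Finset ℕ), ∃ out', i < t → Clean (graphAt σ i) out →
      (∀ v, (out v).card ≤ 2 * α) → Clean (graphAt σ (i + 1)) out' ∧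
      (∀ v, (out' v).card ≤ 2 * α) ∧ flips (graphAt σ i) (graphAt σ (i + 1)) out out' ≤
        Nat.log 2 (graphAt σ (i + 1)).verts.card := by
    intro i out
    -- The recursion needs a successor for every orientation; where the hypotheses fail, the
    -- orientation is left unchanged.
    by_cases hh : i < t ∧ Clean (graphAt σ i) out ∧ ∀ v, (out v).card ≤ 2 * α
    · obtain ⟨o', h'⟩ := exists_orientation_apply (hwf i hh.1.le) hα1 (hσ.legal i hh.1)
        (hσ.arboricity_le (i + 1) hh.1) hh.2.1 hh.2.2
      exact ⟨o', fun _ _ _ => h'⟩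
    · exact ⟨out, fun h1 h2 h3 => absurd ⟨h1, h2, h3⟩ hh⟩
  choose f hf using step
  let o : ℕ → ℕ → Finset ℕ := fun i => Nat.rec (fun _ => ∅) f i
  have ho : ∀ i ≤ t, Clean (graphAt σ i) (o i) ∧ ∀ v, (o i v).card ≤ 2 * α := by
    intro i
    induction i with
    | zero =>
      intro _
      refine ⟨⟨fun u v huv => ?_, fun u v hv => ?_⟩, fun v => ?_⟩
      · simp [graphAt, Network.empty, Network.Adj] at huv
      · simp [o] at hv
      · simp [o]
    | succ i ih =>
      intro hi
      obtain ⟨h1, h2⟩ := ih (by omega)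
      obtain ⟨h3, h4, -⟩ := hf i (o i) (by omega) h1 h2
      exact ⟨h3, h4⟩
  refine ⟨o, fun i hi => ⟨(ho i hi).1.orients, fun v _ => ?_⟩, Finset.sum_le_sum fun i hi => ?_⟩
  · rw [(ho i hi).1.outdegree_eq]; exact (ho i hi).2 v
  · have hi := Finset.mem_range.1 hi
    exact (hf i (o i) hi (ho i hi.le).1 (ho i hi.le).2).2.2

section

/-! ### Peeling: the evolution of the orientation in two rounds -/

/-- The lists of out-neighbours, and the vertices that offer all their outgoing edges to the other
endpoints. -/
@[ext] structure Snapshot where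
  out : ℕ → Finset ℕ
  off : ℕ → Bool

namespace Snapshot

variable (H : Network) (T D N : ℕ) (st : Snapshot)

/-- The vertices whose offers `v` receives. -/
def offers (v : ℕ) : Finset ℕ :=
  H.verts.filter fun w => st.off w = true ∧ v ∈ st.out w ∧ H.Adj w v

/-- The number of offers that `v` receives and makes. -/
def load (v : ℕ) : ℕ := (st.offers H v).card + if st.off v = true then (st.out v).card else 0

/-- The vertices that reject the offer of `v`: those with a load above `T`. -/
def rejecters (v : ℕ) : Finset ℕ :=
  H.verts.filter fun w => st.off v = true ∧ w ∈ st.out v ∧ H.Adj v w ∧ T < st.load H w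

/-- The vertices whose offers `v` accepts. -/
def accepted (v : ℕ) : Finset ℕ := if st.load H v ≤ T then st.offers H v else ∅

/-- The edges that `v` does not offer. -/
def base (v : ℕ) : Finset ℕ := if st.off v = true then ∅ else st.out v

/-- Whether `v` is about to make offers once it knows the answers to its previous offers. -/
def pending (v : ℕ) : Bool :=
  if st.off v = true then decide (T < st.load H v)
  else decide ((st.offers H v).Nonempty ∧ st.load H v ≤ T ∧ D < (st.out v ∪ st.offers H v).card)

/-- The situation after the offers have been answered. -/
def next : Snapshot where
  out v := st.base v ∪ st.accepted H T v ∪ st.rejecters H T v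
  off v := decide (st.pending H T D v = true ∧
    (st.base v ∪ st.accepted H T v ∪ st.rejecters H T v).Nonempty)

/-- The invariants of the update procedure. -/
structure Valid : Prop where
  off_mem : ∀ v, st.off v = true → v ∈ H.verts
  nonempty : ∀ v, st.off v = true → (st.out v).Nonempty
  idle_card : ∀ v, st.off v = false → (st.out v).card ≤ D
  card_le : ∀ v, (st.out v).card ≤ D + T
  orients : Orients H st.out
  lt : ∀ v, ∀ w ∈ st.out v, w < N

variable {H T D N st}

theorem rejecters_subset (v : ℕ) : st.rejecters H T v ⊆ st.out v := fun _ hw =>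
  (Finset.mem_filter.1 hw).2.2.1

theorem rejecters_of_idle {v : ℕ} (h : st.off v = false) : st.rejecters H T v = ∅ := by
  simp [rejecters, h]

theorem accepted_subset (v : ℕ) : st.accepted H T v ⊆ st.offers H v := by
  unfold accepted
  split_ifs <;> simp

theorem card_offers_le_load (v : ℕ) : (st.offers H v).card ≤ st.load H v := Nat.le_add_right _ _

/-- These lists are held between the two rounds of a phase, when an offering vertex has given up its
own entries and waits for rejections. -/
theorem card_base_union_accepted_le (h : st.Valid H T D N) (v : ℕ) :
    (st.base v ∪ st.accepted H T v).card ≤ D + T := by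
  have h1 := card_offers_le_load (H := H) (st := st) v
  refine (Finset.card_union_le _ _).trans (add_le_add ?_ ?_)
  · unfold base
    split_ifs with hv
    · simp
    · exact h.idle_card v (by simpa using hv)
  · unfold accepted
    split_ifs with hl
    · omega
    · simp

theorem card_next_le (h : st.Valid H T D N) (v : ℕ) :
    ((st.next H T D).out v).card ≤ D + T := by
  have h2 := Finset.card_le_card (rejecters_subset (H := H) (T := T) (st := st) v)
  have h1 := card_base_union_accepted_le h v
  simp only [next]
  cases hv : st.off v
  · rw [rejecters_of_idle hv, Finset.union_empty]
    exact h1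
  -- Offers made count towards the load. If `v` accepts, its accepted and rejected edges together
  -- number at most `T`; if not, only a part of its former list remains.
  · have hl : st.load H v = (st.offers H v).card + (st.out v).card := by simp [load, hv]
    simp only [base, hv, if_true, Finset.empty_union]
    refine (Finset.card_union_le _ _).trans ?_
    unfold accepted
    split_ifs with hl'
    · omega
    · have := h.card_le v
      simp only [Finset.card_empty]
      omega

/-- The receiver alone decides on an offer made along a link: it takes the edge, or the offering
side recovers it, never both. The hypothesis `T ≤ D` is needed because a vertex that stops offering
keeps up to `T` entries and must then obey the bound for idle vertices. -/
theorem Valid.next (hH : H.WellFormed) (hTD : T ≤ D) (hN : ∀ v ∈ H.verts, v < N)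
    (h : st.Valid H T D N) : (st.next H T D).Valid H T D N := by
  constructor
  · intro v hv
    simp only [Snapshot.next, pending] at hv
    cases hoff : st.off v
    · simp only [hoff] at hv
      simp at hv
      obtain ⟨w, hw⟩ := hv.1.1
      exact (hH w v (Finset.mem_filter.1 hw).2.2.2).2.1
    · exact h.off_mem v hoff
  · intro v hv
    simp only [Snapshot.next, decide_eq_true_eq] at hv
    exact hv.2
  · intro v hv
    simp only [Snapshot.next, decide_eq_false_iff_not, not_and, Finset.not_nonempty_iff_eq_empty]
      at hv
    simp only [Snapshot.next]
    by_cases hp : st.pending H T D v = true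
    · rw [hv hp]; simp
    · simp only [pending] at hp
      cases hoff : st.off v
      · simp only [hoff, Bool.false_eq_true, if_false, decide_eq_true_eq] at hp
        have hc := h.idle_card v hoff
        rw [rejecters_of_idle hoff, Finset.union_empty]
        simp only [base, hoff, Bool.false_eq_true, if_false, accepted]
        split_ifs with hl
        · by_cases hne : (st.offers H v).Nonempty
          · exact not_lt.1 fun hlt => hp ⟨hne, hl, hlt⟩
          · rw [Finset.not_nonempty_iff_eq_empty.1 hne]; simpa using hc
        · simpa using hc
      · simp only [hoff, if_true, decide_eq_true_eq, not_lt] at hp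
        have h2 := Finset.card_le_card (rejecters_subset (H := H) (T := T) (st := st) v)
        have hl : st.load H v = (st.offers H v).card + (st.out v).card := by simp [load, hoff]
        simp only [base, hoff, if_true, Finset.empty_union, accepted, if_pos hp]
        have := Finset.card_union_le (st.offers H v) (st.rejecters H T v)
        omega
  · exact card_next_le h
  · intro u v huv
    have key : ∀ a b, H.Adj a b → b ∈ st.out a → a ∉ st.out b →
        Xor (b ∈ (st.next H T D).out a) (a ∈ (st.next H T D).out b) := by
      intro a b hab hb ha
      obtain ⟨hav, hbv, -⟩ := hH a b hab
      have h1 : b ∉ st.accepted H T a := fun hh =>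
        ha (Finset.mem_filter.1 (accepted_subset _ hh)).2.2.1
      have h2 : a ∉ st.base b := by
        unfold base
        split_ifs <;> simp [ha]
      have h3 : a ∉ st.rejecters H T b := fun hh => ha (rejecters_subset _ hh)
      simp only [Snapshot.next, Finset.mem_union, h1, h2, h3, false_or, or_false]
      cases hoff : st.off a
      · have h4 : b ∈ st.base a := by simpa [base, hoff] using hb
        have h5 : a ∉ st.accepted H T b := fun hh => by
          have := (Finset.mem_filter.1 (accepted_subset _ hh)).2.1
          simp [hoff] at this
        exact Or.inl ⟨Or.inl h4, h5⟩
      · have h4 : b ∉ st.base a := by simp [base, hoff]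
        by_cases hl : st.load H b ≤ T
        · refine Or.inr ⟨?_, ?_⟩
          · rw [accepted, if_pos hl]
            exact Finset.mem_filter.2 ⟨hav, hoff, hb, hab⟩
          · rintro (hh | hh)
            · exact h4 hh
            · exact absurd (Finset.mem_filter.1 hh).2.2.2.2 (not_lt.2 hl)
        · refine Or.inl ⟨Or.inr (Finset.mem_filter.2 ⟨hbv, hoff, hb, hab, not_le.1 hl⟩), ?_⟩
          simp [accepted, hl]
    rcases h.orients u v huv with hh | hh
    · exact key u v huv hh.1 hh.2
    · exact Or.symm (key v u huv.symm hh.1 hh.2)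
  · intro v w hw
    simp only [Snapshot.next, Finset.mem_union] at hw
    rcases hw with (hw | hw) | hw
    · unfold base at hw
      split_ifs at hw
      · simp at hw
      · exact h.lt v w hw
    · exact hN w (Finset.mem_filter.1 (accepted_subset _ hw)).1
    · exact h.lt v w (rejecters_subset _ hw)

/-! ### The potential -/

variable (H T st)

/-- The entries in `X`, as out-neighbours of `v`, that agree with the orientation `o`. -/
def good (o : ℕ → Finset ℕ) (v : ℕ) (X : Finset ℕ) : Finset ℕ :=
  X.filter fun w => w ∈ o v ∧ H.Adj v w

/-- The entries in `X`, as out-neighbours of `v`, that are outdated or oriented differently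
by `o`. -/
def bad (o : ℕ → Finset ℕ) (v : ℕ) (X : Finset ℕ) : Finset ℕ :=
  X.filter fun w => ¬ (w ∈ o v ∧ H.Adj v w)

/-- The number of offers that are made. -/
def offerCount : ℕ := ∑ v ∈ H.verts, if st.off v = true then (st.out v).card else 0

/-- The potential with respect to the orientation `o`. -/
def potential (o : ℕ → Finset ℕ) : ℕ :=
  ∑ v ∈ H.verts, if st.off v = true then (st.out v).card + 2 * (good H o v (st.out v)).card + 2 * T
    else 2 * (bad H o v (st.out v)).card

variable {H T st}

theorem card_good_add_card_bad (o : ℕ → Finset ℕ) (v : ℕ) (X : Finset ℕ) :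
    (good H o v X).card + (bad H o v X).card = X.card :=
  Finset.card_filter_add_card_filter_not _

theorem card_bad_union_le (o : ℕ → Finset ℕ) (v : ℕ) (X Y : Finset ℕ) :
    (bad H o v (X ∪ Y)).card ≤ (bad H o v X).card + (bad H o v Y).card := by
  unfold bad
  rw [Finset.filter_union]
  exact Finset.card_union_le _ _

theorem card_good_le {δ : ℕ} {o : ℕ → Finset ℕ} (ho : IsOrientation δ H o) {v : ℕ}
    (hv : v ∈ H.verts) (X : Finset ℕ) : (good H o v X).card ≤ δ := by
  refine (Finset.card_le_card ?_).trans (ho.2 v hv)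
  intro w hw
  have := (Finset.mem_filter.1 hw).2
  exact Finset.mem_filter.2 ⟨this.1, this.2⟩

/-- Starting to offer a long list does not increase the potential. -/
theorem offering_le_idle {δ : ℕ} {o : ℕ → Finset ℕ} (ho : IsOrientation δ H o) {v : ℕ}
    (hv : v ∈ H.verts) (hD : 4 * δ + 2 * T ≤ D) {X : Finset ℕ} (hX : D < X.card) :
    X.card + 2 * (good H o v X).card + 2 * T ≤ 2 * (bad H o v X).card := by
  have h1 := card_good_le ho hv X
  have h2 := card_good_add_card_bad (H := H) o v X
  omega

/-- An accepted edge that is bad at its new tail was good at its old tail, and it is not among the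
rejected ones there. So the good entries of the offering vertices pay both for the bad entries
created by acceptance and for the good entries that are returned. -/
theorem sum_bad_accepted_le {δ : ℕ} {o : ℕ → Finset ℕ}
    (ho : IsOrientation δ H o) :
    ∑ v ∈ H.verts, (bad H o v (st.accepted H T v)).card +
      ∑ v ∈ H.verts.filter (st.off · = true), (good H o v (st.rejecters H T v)).card ≤
    ∑ v ∈ H.verts.filter (st.off · = true), (good H o v (st.out v)).card := by
  have h1 : ∑ v ∈ H.verts, (bad H o v (st.accepted H T v)).card ≤
      ∑ v ∈ H.verts.filter (st.off · = true),
        (good H o v (st.out v \ st.rejecters H T v)).card := by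
    rw [← Finset.card_sigma, ← Finset.card_sigma]
    refine Finset.card_le_card_of_injOn (fun p => ⟨p.2, p.1⟩) ?_ ?_
    · rintro ⟨v, w⟩ hp
      simp only [Finset.coe_sigma, Set.mem_sigma_iff, Finset.mem_coe, bad, good, Finset.mem_filter,
        Finset.mem_sdiff] at hp ⊢
      obtain ⟨hv, hw, hbad⟩ := hp
      have hl : st.load H v ≤ T := by
        by_contra hl
        simp [accepted, hl] at hw
      obtain ⟨h1, h2, h3, h4⟩ := Finset.mem_filter.1 (accepted_subset _ hw)
      refine ⟨⟨h1, h2⟩, ⟨h3, fun hh => ?_⟩, ?_, h4⟩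
      · exact absurd (Finset.mem_filter.1 hh).2.2.2.2 (not_lt.2 hl)
      · rcases ho.1 w v h4 with hh | hh
        · exact hh.1
        · exact absurd ⟨hh.1, h4.symm⟩ hbad
    · rintro ⟨a, b⟩ _ ⟨c, d⟩ _ h
      simp only [Sigma.mk.injEq, heq_eq_eq] at h ⊢
      exact ⟨h.2, h.1⟩
  refine (Nat.add_le_add_right h1 _).trans ?_
  rw [← Finset.sum_add_distrib]
  refine Finset.sum_le_sum fun v _ => ?_
  unfold good
  rw [← Finset.card_union_of_disjoint (Finset.disjoint_filter_filter Finset.sdiff_disjoint),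
    ← Finset.filter_union, Finset.sdiff_union_of_subset (rejecters_subset v)]

/-- Every offer counts once at its sender and at most once at its receiver. -/
theorem sum_load_le : ∑ v ∈ H.verts, st.load H v ≤ 2 * st.offerCount H := by
  have h1 : ∑ v ∈ H.verts, (st.offers H v).card ≤ st.offerCount H := by
    unfold offerCount
    rw [← Finset.sum_filter, ← Finset.card_sigma, ← Finset.card_sigma]
    refine Finset.card_le_card_of_injOn (fun p => ⟨p.2, p.1⟩) ?_ ?_
    · rintro ⟨v, w⟩ hp
      simp only [Finset.coe_sigma, Set.mem_sigma_iff, Finset.mem_coe, offers, Finset.mem_filter]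
        at hp ⊢
      tauto
    · rintro ⟨a, b⟩ _ ⟨c, d⟩ _ h
      simp only [Sigma.mk.injEq, heq_eq_eq] at h ⊢
      exact ⟨h.2, h.1⟩
  simp only [load, Finset.sum_add_distrib]
  unfold offerCount at *
  omega

/-- At least half of the offers come to an end. -/
theorem two_mul_sum_rejecters_le {α : ℕ} (hH : H.WellFormed) (hα : H.arboricity ≤ α)
    (h : st.Valid H (4 * α) D N) :
    2 * ∑ v ∈ (H.verts.filter (st.off · = true)),
      (if 4 * α < st.load H v then (st.rejecters H (4 * α) v).card else 0) ≤ st.offerCount H := by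
  set U := H.verts.filter fun v => 4 * α < st.load H v with hU
  -- A surviving offer has an overloaded sender and an overloaded receiver, so it is a link inside
  -- `U`. There are at most `α * |U|` of these, while `4 * α * |U|` is at most twice the number of
  -- offers.
  have h1 : U.card * (4 * α) ≤ ∑ v ∈ U, st.load H v := by
    rw [← smul_eq_mul]
    exact Finset.card_nsmul_le_sum _ _ _ fun v hv => (Finset.mem_filter.1 hv).2.le
  have h2 : ∑ v ∈ U, st.load H v ≤ 2 * st.offerCount H :=
    (Finset.sum_le_sum_of_subset (Finset.filter_subset _ _)).trans sum_load_le
  have h3 := card_linksIn_le hH hα (Finset.filter_subset (fun v => 4 * α < st.load H v) H.verts)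
  have h4 : α * (U.card - 1) ≤ α * U.card := Nat.mul_le_mul_left _ (Nat.sub_le _ _)
  have h5 : ∑ v ∈ (H.verts.filter (st.off · = true)),
      (if 4 * α < st.load H v then (st.rejecters H (4 * α) v).card else 0) ≤
      (H.linksIn U).card := by
    rw [← Finset.sum_filter, ← Finset.card_sigma,
      ← Finset.card_map (Equiv.sigmaEquivProd ℕ ℕ).toEmbedding]
    refine card_le_card_links ?_ ?_
    · rintro ⟨x, y⟩ hp
      simp only [Finset.mem_map_equiv, Finset.mem_sigma, Equiv.sigmaEquivProd_symm_apply,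
        Finset.mem_filter, rejecters] at hp
      simp only [Network.linksIn, Finset.mem_inter, Finset.mk_mem_sym2_iff, U, Finset.mem_filter]
      exact ⟨hp.2.2.2.2.1, ⟨hp.1.1.1, hp.1.2⟩, hp.2.1, hp.2.2.2.2.2⟩
    · rintro ⟨x, y⟩ hp hq
      simp only [Finset.mem_map_equiv, Finset.mem_sigma, Equiv.sigmaEquivProd_symm_apply,
        Finset.mem_filter, rejecters] at hp hq
      rcases h.orients x y hp.2.2.2.2.1 with hh | hh
      · exact hh.2 hq.2.2.2.1
      · exact hh.2 hp.2.2.2.1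
  have h6 : 4 * (α * U.card) = U.card * (4 * α) := by ring
  rw [← hU] at h3
  omega

/-- The edges newly accepted by `v` are kept as a separate summand, because their price is paid by
other vertices, through `sum_bad_accepted_le`. The list size is charged only for an overloaded
offering vertex, the only kind that can go on offering. -/
theorem potential_next_vertex_le {δ : ℕ} {o : ℕ → Finset ℕ} (ho : IsOrientation δ H o)
    (hD : 4 * δ + 2 * T ≤ D) {v : ℕ} (hv : v ∈ H.verts) :
    (if (st.next H T D).off v = true then ((st.next H T D).out v).card +
        2 * (good H o v ((st.next H T D).out v)).card + 2 * T
      else 2 * (bad H o v ((st.next H T D).out v)).card) ≤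
    2 * (bad H o v (st.accepted H T v)).card +
      if st.off v = true then (if T < st.load H v then (st.rejecters H T v).card else 0) +
        2 * (good H o v (st.rejecters H T v)).card + 2 * T
      else 2 * (bad H o v (st.out v)).card := by
  cases hoff : st.off v
  · have hout : (st.next H T D).out v = st.out v ∪ st.accepted H T v := by
      simp [next, rejecters_of_idle hoff, base, hoff]
    have h1 : 2 * (bad H o v ((st.next H T D).out v)).card ≤
        2 * (bad H o v (st.accepted H T v)).card + 2 * (bad H o v (st.out v)).card := by
      rw [hout]
      have := card_bad_union_le (H := H) o v (st.out v) (st.accepted H T v)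
      omega
    simp only [Bool.false_eq_true, if_false]
    split_ifs with hn
    -- An idle vertex starts offering only with more than `D` entries, which is free.
    · refine (offering_le_idle ho hv hD ?_).trans h1
      simp only [next, pending, hoff, Bool.false_eq_true, if_false, decide_eq_true_eq] at hn
      rw [hout, accepted, if_pos hn.1.2.1]
      exact hn.1.2.2
    · exact h1
  · simp only [if_true]
    have hout : (st.next H T D).out v = st.accepted H T v ∪ st.rejecters H T v := by
      simp [next, base, hoff]
    by_cases hl : T < st.load H v
    · have hacc : st.accepted H T v = ∅ := by simp [accepted, hl]
      rw [hacc, Finset.empty_union] at hout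
      rw [hout, if_pos hl]
      split_ifs with hn
      · omega
      · have : st.rejecters H T v = ∅ := by
          simp only [next, pending, hoff, if_true, decide_eq_true_eq, not_and, hl, true_imp_iff,
            Finset.not_nonempty_iff_eq_empty, Finset.union_eq_empty] at hn
          exact hn.2
        rw [this]; simp [bad]
    -- Here `v` stops offering. Its returned entries number at most its load, hence at most `T`, and
    -- `2 * T` covers them even if all are bad.
    · have hn : ¬ (st.next H T D).off v = true := by simp [next, pending, hoff, hl]
      rw [if_neg hn, if_neg hl, hout]
      have h1 := card_bad_union_le (H := H) o v (st.accepted H T v) (st.rejecters H T v)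
      have h2 := Finset.card_le_card (rejecters_subset (H := H) (T := T) (st := st) v)
      have h3 := card_good_add_card_bad (H := H) o v (st.rejecters H T v)
      have h4 : st.load H v = (st.offers H v).card + (st.out v).card := by simp [load, hoff]
      omega

/-- The potential pays for the offers. -/
theorem potential_next_le {α δ : ℕ} {o : ℕ → Finset ℕ} (hH : H.WellFormed)
    (hα : H.arboricity ≤ α) (ho : IsOrientation δ H o) (hD : 4 * δ + 2 * (4 * α) ≤ D)
    (h : st.Valid H (4 * α) D N) :
    2 * (st.next H (4 * α) D).potential H (4 * α) o + st.offerCount H ≤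
      2 * st.potential H (4 * α) o := by
  have h1 : (st.next H (4 * α) D).potential H (4 * α) o ≤ _ :=
    Finset.sum_le_sum fun v (hv : v ∈ H.verts) => potential_next_vertex_le (st := st) ho hD hv
  have h2 := sum_bad_accepted_le (st := st) (T := 4 * α) ho
  have h3 := two_mul_sum_rejecters_le hH hα h
  rw [Finset.sum_add_distrib, ← Finset.mul_sum, Finset.sum_ite, Finset.sum_add_distrib,
    Finset.sum_add_distrib, ← Finset.mul_sum] at h1
  have h4 : st.potential H (4 * α) o = st.offerCount H +
      2 * ∑ v ∈ H.verts.filter (st.off · = true), (good H o v (st.out v)).card +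
      ∑ v ∈ H.verts.filter (st.off · = true), 2 * (4 * α) +
      ∑ v ∈ H.verts.filter (fun v => ¬ st.off v = true), 2 * (bad H o v (st.out v)).card := by
    unfold potential offerCount
    rw [Finset.sum_ite, Finset.sum_add_distrib, Finset.sum_add_distrib, ← Finset.mul_sum,
      ← Finset.sum_filter]
  omega

end Snapshot

end

section

/-! ### The protocol -/

/-- The message `x` to all processors in `S`. -/
def mailTo (S : Finset ℕ) (x : ℕ) : Mail := Finsupp.indicator S fun _ _ => x

/-- The processors from which the message `x` has arrived. -/
def senders (x : ℕ) (m : Mail) : Finset ℕ := m.support.filter fun w => m w = x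

theorem mailTo_apply (S : Finset ℕ) (x w : ℕ) : mailTo S x w = if w ∈ S then x else 0 := by
  simp [mailTo, Finsupp.indicator_apply]

theorem mailTo_empty (x : ℕ) : mailTo ∅ x = 0 := by
  ext w; simp [mailTo_apply]

theorem card_support_mailTo_le (S : Finset ℕ) (x : ℕ) : (mailTo S x).support.card ≤ S.card :=
  Finset.card_le_card fun w hw => by
    by_contra h
    simp [mailTo_apply, h] at hw

theorem senders_zero (x : ℕ) : senders x 0 = ∅ := by simp [senders]

theorem senders_mailTo {x : ℕ} (hx : x ≠ 0) (S : Finset ℕ) : senders x (mailTo S x) = S := by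
  ext w
  simp only [senders, mailTo_apply, Finset.mem_filter, Finsupp.mem_support_iff]
  split_ifs with h <;> simp [h, hx]

theorem senders_mailTo_of_ne {x y : ℕ} (hxy : x ≠ y) (S : Finset ℕ) :
    senders y (mailTo S x) = ∅ := by
  ext w
  simp only [senders, mailTo_apply, Finset.mem_filter, Finsupp.mem_support_iff]
  split_ifs <;> simp [hxy]

/-- A processor whose list of out-neighbours exceeds `D` offers (message `1`) to reverse its
outgoing edges. A processor that receives and has made at most `T` offers accepts tacitly and
retires; otherwise it rejects (message `2`). Offers that are not rejected are erased from the list;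
this also removes outdated entries. The work space is `[1]` when offers have been made, `[2]` when
offers are to be made in the next round, and empty otherwise. -/
def peeling (T D : ℕ) : Protocol where
  wake v m
    | .edgeInserted w =>
      -- Identifiers break the symmetry. The larger endpoint erases the entry, since it may still
      -- hold an outdated one from an earlier edge between the two processors.
      if v < w then
        (⟨insert w m.out, if D < (insert w m.out).card then [1] else m.work⟩,
          if D < (insert w m.out).card then mailTo (insert w m.out) 1 else 0)
      else (⟨m.out.erase w, m.work⟩, 0)
    | .edgeDeleted w => (⟨m.out.erase w, m.work⟩, 0)
    | _ => (m, 0)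
  active _ m := decide (m.work ≠ [])
  step _ m inbox :=
    let S := senders 1 inbox
    let R := senders 2 inbox
    if m.work = [2] then
      (⟨m.out ∪ R, if (m.out ∪ R).Nonempty then [1] else []⟩, mailTo (m.out ∪ R) 1)
    else
      let l := S.card + if m.work = [1] then m.out.card else 0
      let X := (if m.work = [1] then ∅ else m.out) ∪ (if l ≤ T then S else ∅) ∪ R
      (⟨X, if (if m.work = [1] then T < l else S.Nonempty ∧ l ≤ T ∧ D < X.card) then [2] else []⟩,
        if T < l then mailTo S 2 else 0)

variable {H : Network} {T D N : ℕ} {st : Snapshot}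

/-- The configuration in which the offers have just been made. -/
def Snapshot.toConfig (st : Snapshot) : Config where
  mem v := ⟨st.out v, if st.off v = true then [1] else []⟩
  sent v := if st.off v = true then mailTo (st.out v) 1 else 0

/-- The configuration in which the offers have just been answered. -/
def Snapshot.midConfig (H : Network) (T D : ℕ) (st : Snapshot) : Config where
  mem v := ⟨st.base v ∪ st.accepted H T v, if st.pending H T D v = true then [2] else []⟩
  sent v := if T < st.load H v then mailTo (st.offers H v) 2 else 0

theorem inbox_toConfig (v : ℕ) : inbox H st.toConfig v = mailTo (st.offers H v) 1 := by
  ext w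
  simp only [inbox, Finsupp.onFinset_apply, mailTo_apply, Snapshot.toConfig, Snapshot.offers,
    Finset.mem_filter]
  by_cases h1 : w ∈ H.verts <;> by_cases h2 : H.Adj w v <;> cases h3 : st.off w <;>
    simp [h1, h2, mailTo_apply]

theorem inbox_midConfig (hH : H.WellFormed) (v : ℕ) :
    inbox H (st.midConfig H T D) v = mailTo (st.rejecters H T v) 2 := by
  ext w
  simp only [inbox, Finsupp.onFinset_apply, mailTo_apply, Snapshot.midConfig, Snapshot.rejecters,
    Finset.mem_filter]
  by_cases h2 : H.Adj w v
  · obtain ⟨hw, hv, -⟩ := hH w v h2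
    by_cases h3 : T < st.load H w <;>
      simp [h2, h2.symm, h3, hw, hv, mailTo_apply, Snapshot.offers]
  · have h2' : ¬ H.Adj v w := fun h => h2 h.symm
    simp [h2, h2']

theorem peeling_step_idle (v : ℕ) (X : Finset ℕ) :
    (peeling T D).step v ⟨X, []⟩ 0 = (⟨X, []⟩, 0) := by
  simp [peeling, senders_zero]

/-- An idle processor without mail would not change by executing `step`, so the activity test can be
dropped. -/
theorem localStep_peeling (hH : H.WellFormed) {c : Config} {v : ℕ}
    (h : v ∉ H.verts → (c.mem v).work = []) :
    localStep (peeling T D) H c v = (peeling T D).step v (c.mem v) (inbox H c v) := by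
  have hinbox : v ∉ H.verts → inbox H c v = 0 := by
    intro hv
    ext w
    simp only [inbox, Finsupp.onFinset_apply, Finsupp.coe_zero, Pi.zero_apply]
    exact if_neg fun hh => hv (hH w v hh.2).2.1
  have hidle : (c.mem v).work = [] → inbox H c v = 0 →
      (c.mem v, 0) = (peeling T D).step v (c.mem v) (inbox H c v) := by
    intro h1 h2
    rw [h2]
    have : c.mem v = ⟨(c.mem v).out, []⟩ := by rw [← h1]
    rw [this, peeling_step_idle]
  unfold localStep
  split_ifs with hcond
  · rfl
  · by_cases hv : v ∈ H.verts
    · have h1 : ¬ ((peeling T D).active v (c.mem v) = true ∨ inbox H c v ≠ 0) :=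
        fun hh => hcond ⟨hv, hh⟩
      simp only [peeling, decide_eq_true_eq, not_or, not_not] at h1
      exact hidle h1.1 h1.2
    · exact hidle (h hv) (hinbox hv)

theorem not_pending_of_notMem (hH : H.WellFormed) (h : st.Valid H T D N) {v : ℕ}
    (hv : v ∉ H.verts) : st.pending H T D v = false := by
  have h1 : st.off v = false := by
    cases hoff : st.off v
    · rfl
    · exact absurd (h.off_mem v hoff) hv
  have h2 : ¬ (st.offers H v).Nonempty := by
    rintro ⟨w, hw⟩
    exact hv (hH w v (Finset.mem_filter.1 hw).2.2.2).2.1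
  simp [Snapshot.pending, h1, h2]

theorem syncRound_toConfig (hH : H.WellFormed) (h : st.Valid H T D N) :
    syncRound (peeling T D) H st.toConfig = st.midConfig H T D := by
  have key : ∀ v, localStep (peeling T D) H st.toConfig v =
      ((st.midConfig H T D).mem v, (st.midConfig H T D).sent v) := by
    intro v
    rw [localStep_peeling hH, inbox_toConfig]
    · cases hoff : st.off v
      · simp only [peeling, Snapshot.toConfig, hoff, Snapshot.midConfig, Snapshot.pending,
          Snapshot.base, Snapshot.accepted, Snapshot.load, senders_mailTo one_ne_zero,
          senders_mailTo_of_ne (show (1 : ℕ) ≠ 2 by norm_num)]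
        by_cases hl : (st.offers H v).card ≤ T <;> simp [hl]
      · simp only [peeling, Snapshot.toConfig, hoff, Snapshot.midConfig, Snapshot.pending,
          Snapshot.base, Snapshot.accepted, Snapshot.load, senders_mailTo one_ne_zero,
          senders_mailTo_of_ne (show (1 : ℕ) ≠ 2 by norm_num)]
        simp
    · intro hv
      have : ¬ st.off v = true := fun hh => hv (h.off_mem v hh)
      simp [Snapshot.toConfig, this]
  unfold syncRound
  simp only [key]

theorem syncRound_midConfig (hH : H.WellFormed) (h : st.Valid H T D N) :
    syncRound (peeling T D) H (st.midConfig H T D) = (st.next H T D).toConfig := by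
  have key : ∀ v, localStep (peeling T D) H (st.midConfig H T D) v =
      ((st.next H T D).toConfig.mem v, (st.next H T D).toConfig.sent v) := by
    intro v
    rw [localStep_peeling hH, inbox_midConfig hH]
    · cases hp : st.pending H T D v
      · simp [peeling, Snapshot.toConfig, Snapshot.midConfig, Snapshot.next, hp,
          senders_mailTo (show (2 : ℕ) ≠ 0 by norm_num),
          senders_mailTo_of_ne (show (2 : ℕ) ≠ 1 by norm_num)]
      · by_cases hne : (st.base v ∪ st.accepted H T v ∪ st.rejecters H T v).Nonempty
        · simp only [peeling, Snapshot.toConfig, Snapshot.midConfig, Snapshot.next, hp,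
            senders_mailTo (show (2 : ℕ) ≠ 0 by norm_num), hne, decide_true, and_self, if_true]
        · simp only [peeling, Snapshot.toConfig, Snapshot.midConfig, Snapshot.next, hp,
            senders_mailTo (show (2 : ℕ) ≠ 0 by norm_num), hne, and_false, decide_false, if_true,
            if_false, Bool.false_eq_true]
          rw [Finset.not_nonempty_iff_eq_empty.1 hne, mailTo_empty]
    · intro hv
      simp [Snapshot.midConfig, not_pending_of_notMem hH h hv]
  unfold syncRound
  simp only [key]

theorem Snapshot.Valid.iterate (hH : H.WellFormed) (hTD : T ≤ D) (hN : ∀ v ∈ H.verts, v < N)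
    (h : st.Valid H T D N) (j : ℕ) : ((Snapshot.next H T D)^[j] st).Valid H T D N := by
  induction j with
  | zero => exact h
  | succ j ih =>
    rw [Function.iterate_succ_apply']
    exact ih.next hH hTD hN

theorem iterate_even (hH : H.WellFormed) (hTD : T ≤ D) (hN : ∀ v ∈ H.verts, v < N)
    (h : st.Valid H T D N) (j : ℕ) :
    (syncRound (peeling T D) H)^[2 * j] st.toConfig =
      ((Snapshot.next H T D)^[j] st).toConfig := by
  induction j with
  | zero => rfl
  | succ j ih =>
    have hj := h.iterate hH hTD hN j
    rw [show 2 * (j + 1) = 2 * j + 1 + 1 by ring, Function.iterate_succ_apply',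
      Function.iterate_succ_apply', ih, syncRound_toConfig hH hj, syncRound_midConfig hH hj,
      Function.iterate_succ_apply']

theorem iterate_odd (hH : H.WellFormed) (hTD : T ≤ D) (hN : ∀ v ∈ H.verts, v < N)
    (h : st.Valid H T D N) (j : ℕ) :
    (syncRound (peeling T D) H)^[2 * j + 1] st.toConfig =
      ((Snapshot.next H T D)^[j] st).midConfig H T D := by
  rw [Function.iterate_succ_apply', iterate_even hH hTD hN h,
    syncRound_toConfig hH (h.iterate hH hTD hN j)]

/-! ### Memory and word size -/

theorem size_toConfig_le (h : st.Valid H T D N) (v : ℕ) :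
    (st.toConfig.mem v).size ≤ D + T + 1 := by
  have := h.card_le v
  simp only [Snapshot.toConfig, Memory.size]
  split_ifs <;> simp <;> omega

theorem size_midConfig_le (h : st.Valid H T D N) (v : ℕ) :
    ((st.midConfig H T D).mem v).size ≤ D + T + 1 := by
  have := Snapshot.card_base_union_accepted_le h v
  simp only [Snapshot.midConfig, Memory.size]
  split_ifs <;> simp <;> omega

theorem size_mailTo_le {b x : ℕ} (hx : Nat.size x ≤ b) (S : Finset ℕ) (w : ℕ) :
    Nat.size (mailTo S x w) ≤ b := by
  rw [mailTo_apply]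
  split_ifs
  · exact hx
  · simp

theorem fitsIn_toConfig {b : ℕ} (hb : 2 ≤ b) (hNb : ∀ w < N, Nat.size w ≤ b)
    (h : st.Valid H T D N) (v : ℕ) :
    (st.toConfig.mem v).FitsIn b ∧ ∀ w, Nat.size (st.toConfig.sent v w) ≤ b := by
  have h1 : Nat.size 1 ≤ b := by simp; omega
  refine ⟨⟨fun w hw => hNb w (h.lt v w hw), fun x hx => ?_⟩, fun w => ?_⟩
  · simp only [Snapshot.toConfig] at hx
    split_ifs at hx
    · rw [List.mem_singleton.1 hx]; exact h1
    · simp at hx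
  · simp only [Snapshot.toConfig]
    split_ifs
    · exact size_mailTo_le h1 _ _
    · simp

theorem fitsIn_midConfig {b : ℕ} (hb : 2 ≤ b) (hNb : ∀ w < N, Nat.size w ≤ b)
    (hN : ∀ v ∈ H.verts, v < N) (h : st.Valid H T D N) (v : ℕ) :
    ((st.midConfig H T D).mem v).FitsIn b ∧
      ∀ w, Nat.size ((st.midConfig H T D).sent v w) ≤ b := by
  have h2 : Nat.size 2 ≤ b := (Nat.size_le.2 (by norm_num : 2 < 2 ^ 2)).trans hb
  refine ⟨⟨fun w hw => hNb w ?_, fun x hx => ?_⟩, fun w => ?_⟩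
  · simp only [Snapshot.midConfig, Finset.mem_union] at hw
    rcases hw with hw | hw
    · unfold Snapshot.base at hw
      split_ifs at hw
      · simp at hw
      · exact h.lt v w hw
    · exact hN w (Finset.mem_filter.1 (Snapshot.accepted_subset _ hw)).1
  · simp only [Snapshot.midConfig] at hx
    split_ifs at hx
    · rw [List.mem_singleton.1 hx]; exact h2
    · simp at hx
  · simp only [Snapshot.midConfig]
    split_ifs
    · exact size_mailTo_le h2 _ _
    · simp

/-! ### Cost of a procedure -/

theorem sentCount_toConfig_le : sentCount H st.toConfig ≤ st.offerCount H := by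
  refine Finset.sum_le_sum fun v _ => ?_
  simp only [Snapshot.toConfig]
  split_ifs
  · exact card_support_mailTo_le _ _
  · simp

theorem sentCount_midConfig_le : sentCount H (st.midConfig H T D) ≤ 2 * st.offerCount H := by
  refine le_trans (Finset.sum_le_sum fun v _ => ?_) (Snapshot.sum_load_le (H := H) (st := st))
  simp only [Snapshot.midConfig]
  split_ifs
  · exact (card_support_mailTo_le _ _).trans (Snapshot.card_offers_le_load v)
  · simp

theorem one_le_offerCount (h : st.Valid H T D N) {v : ℕ} (hv : st.off v = true) :
    1 ≤ st.offerCount H := by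
  unfold Snapshot.offerCount
  refine le_trans ?_ (Finset.single_le_sum (fun _ _ => Nat.zero_le _) (h.off_mem v hv))
  rw [if_pos hv]
  exact Finset.card_pos.2 (h.nonempty v hv)

theorem quiet_toConfig (h : ∀ v, st.off v = false) :
    Quiet (peeling T D) H st.toConfig := by
  intro v _
  simp [Snapshot.toConfig, h v, peeling]

/-- The procedure terminates, and the potential pays for the rounds and messages. -/
theorem exists_idle {α δ : ℕ} {o : ℕ → Finset ℕ} (hH : H.WellFormed) (hα : H.arboricity ≤ α)
    (hN : ∀ v ∈ H.verts, v < N) (ho : IsOrientation δ H o) (hD : 4 * δ + 8 * α ≤ D)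
    (h : st.Valid H (4 * α) D N) :
    ∃ j, (∀ v, ((Snapshot.next H (4 * α) D)^[j] st).off v = false) ∧
      ∑ k ∈ Finset.range (2 * j),
        sentCount H ((syncRound (peeling (4 * α) D) H)^[k] st.toConfig) +
        6 * ((Snapshot.next H (4 * α) D)^[j] st).potential H (4 * α) o ≤
        6 * st.potential H (4 * α) o ∧
      2 * j + 6 * ((Snapshot.next H (4 * α) D)^[j] st).potential H (4 * α) o ≤
        6 * st.potential H (4 * α) o := by
  have hTD : 4 * α ≤ D := by omega
  have step := fun j => Snapshot.potential_next_le hH hα ho (by omega) (h.iterate hH hTD hN j)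
  -- A phase costs at most three times the number of offers: once for the offers, and twice as a
  -- crude bound for the rejections. The potential drops by at least half that number, whence the
  -- factor 6.
  have hcost : ∀ j, ∑ k ∈ Finset.range (2 * j),
        sentCount H ((syncRound (peeling (4 * α) D) H)^[k] st.toConfig) +
        6 * ((Snapshot.next H (4 * α) D)^[j] st).potential H (4 * α) o ≤
        6 * st.potential H (4 * α) o := by
    intro j
    induction j with
    | zero => simp
    | succ j ih =>
      rw [show 2 * (j + 1) = 2 * j + 1 + 1 by ring, Finset.sum_range_succ, Finset.sum_range_succ,
        iterate_even hH hTD hN h, iterate_odd hH hTD hN h, Function.iterate_succ_apply']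
      have h1 := step j
      have h2 := sentCount_toConfig_le (H := H) (st := (Snapshot.next H (4 * α) D)^[j] st)
      have h3 := sentCount_midConfig_le (H := H) (T := 4 * α) (D := D)
        (st := (Snapshot.next H (4 * α) D)^[j] st)
      omega
  -- Offering vertices have nonempty lists, so a phase that is not idle contains an offer and the
  -- drop in potential pays for its two rounds. In particular, only finitely many such phases are
  -- possible.
  have hrounds : ∀ j, (∀ i < j, ∃ v, ((Snapshot.next H (4 * α) D)^[i] st).off v = true) →
      2 * j + 6 * ((Snapshot.next H (4 * α) D)^[j] st).potential H (4 * α) o ≤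
        6 * st.potential H (4 * α) o := by
    intro j
    induction j with
    | zero => simp
    | succ j ih =>
      intro hj
      have h0 := ih fun i hi => hj i (by omega)
      obtain ⟨v, hv⟩ := hj j (by omega)
      have h1 := step j
      have h2 := one_le_offerCount (h.iterate hH hTD hN j) hv
      rw [Function.iterate_succ_apply']
      omega
  have hex : ∃ j, ∀ v, ((Snapshot.next H (4 * α) D)^[j] st).off v = false := by
    by_contra! hcon
    have := hrounds (6 * st.potential H (4 * α) o + 1) fun i _ => by simpa using hcon i
    omega
  classical
  refine ⟨Nat.find hex, Nat.find_spec hex, hcost _, hrounds _ fun i hi => ?_⟩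
  simpa using Nat.find_min hex hi

/-! ### Stability of quiet configurations. -/

theorem syncRound_mem_of_quiet {A : Protocol} {c : Config} (h : Quiet A H c) :
    (syncRound A H c).mem = c.mem ∧ Quiet A H (syncRound A H c) := by
  have key : ∀ v, localStep A H c v = (c.mem v, 0) := by
    intro v
    have h1 : inbox H c v = 0 := by
      ext w
      simp only [inbox, Finsupp.onFinset_apply, Finsupp.coe_zero, Pi.zero_apply]
      split_ifs with hw
      · simp [(h w hw.1).1]
      · rfl
    unfold localStep
    rw [if_neg]
    rintro ⟨hv, hh⟩
    simp [h1, (h v hv).2] at hh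
  refine ⟨by simp [syncRound, key], fun v hv => ?_⟩
  simpa [syncRound, key] using (h v hv).2

theorem iterate_mem_of_quiet {A : Protocol} {c : Config} (h : Quiet A H c) (k : ℕ) :
    ((syncRound A H)^[k] c).mem = c.mem ∧ Quiet A H ((syncRound A H)^[k] c) := by
  induction k with
  | zero => exact ⟨rfl, h⟩
  | succ k ih =>
    rw [Function.iterate_succ_apply']
    have := syncRound_mem_of_quiet ih.2
    exact ⟨this.1.trans ih.1, this.2⟩

theorem duration_le {A : Protocol} {G : Network} {mem : ℕ → Memory} {e : Update} {k : ℕ}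
    (h : Quiet A (duringUpdate G e) (configAfter A G mem e k)) : duration A G mem e ≤ k :=
  Nat.sInf_le h

/-- Memories do not change after the first quiet moment, so any later quiet moment may stand in for
the exact duration. -/
theorem configAfter_duration_mem {A : Protocol} {G : Network} {mem : ℕ → Memory} {e : Update}
    {k : ℕ} (h : Quiet A (duringUpdate G e) (configAfter A G mem e k)) :
    (configAfter A G mem e (duration A G mem e)).mem = (configAfter A G mem e k).mem := by
  have hq : Quiet A (duringUpdate G e) (configAfter A G mem e (duration A G mem e)) :=
    Nat.sInf_mem (s := {k | Quiet A (duringUpdate G e) (configAfter A G mem e k)}) ⟨k, h⟩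
  obtain ⟨m, hm⟩ := Nat.exists_eq_add_of_le (duration_le h)
  have := (iterate_mem_of_quiet hq m).1
  rw [hm]
  unfold configAfter at *
  rw [add_comm, Function.iterate_add_apply]
  exact this.symm

end

section

/-! ### A single update -/

/-- The invariants between updates. -/
structure Ready (N D : ℕ) (G : Network) (mem : ℕ → Memory) : Prop where
  work : ∀ v, (mem v).work = []
  card_le : ∀ v, (mem v).out.card ≤ D
  lt : ∀ v, ∀ w ∈ (mem v).out, w < N
  orients : Orients G fun v => (mem v).out

/-- The lists of out-neighbours at the beginning of the update procedure. -/
def wokenOut (out : ℕ → Finset ℕ) : Update → ℕ → Finset ℕ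
  | .insertVertex v, x => if x = v then ∅ else out x
  | .deleteVertex _, x => out x
  | .insertEdge u v, x =>
      if x = min u v then insert (max u v) (out x)
      else if x = max u v then (out x).erase (min u v) else out x
  | .deleteEdge u v, x =>
      if x = u then (out x).erase v else if x = v then (out x).erase u else out x

/-- The situation at the beginning of the update procedure. -/
def woken (D : ℕ) (out : ℕ → Finset ℕ) (e : Update) : Snapshot where
  out := wokenOut out e
  off x := decide (D < (wokenOut out e x).card)

variable {G : Network} {T D N : ℕ} {mem : ℕ → Memory} {e : Update}

theorem mem_wokenOut_insertEdge {out : ℕ → Finset ℕ} {u v x y : ℕ} (huv : u ≠ v) :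
    y ∈ wokenOut out (.insertEdge u v) x ↔ (x = min u v ∧ y = max u v) ∨
      (y ∈ out x ∧ ¬ (x = max u v ∧ y = min u v)) := by
  have : min u v ≠ max u v := by omega
  simp only [wokenOut]
  split_ifs with h1 h2
  · subst h1; simp; grind
  · subst h2; simp [Finset.mem_erase]; grind
  · grind

theorem wokenOut_card_le {out : ℕ → Finset ℕ} (h : ∀ v, (out v).card ≤ D) (x : ℕ) :
    (wokenOut out e x).card ≤ D + 1 := by
  have h1 := h x
  cases e <;> simp only [wokenOut]
  · split_ifs <;> simp; omega
  · omega
  · split_ifs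
    · exact (Finset.card_insert_le _ _).trans (by omega)
    · exact (Finset.card_erase_le).trans (by omega)
    · omega
  · split_ifs
    · exact (Finset.card_erase_le).trans (by omega)
    · exact (Finset.card_erase_le).trans (by omega)
    · omega

/-- All lists have at most `D` entries beforehand, so the smaller endpoint of an inserted edge is
the only processor that can begin with offers. -/
theorem start_peeling (he : e.Legal G) (h : Ready N D G mem) :
    start (peeling T D) mem e = (woken D (fun v => (mem v).out) e).toConfig := by
  have hmem : ∀ x, mem x = ⟨(mem x).out, []⟩ := fun x => by
    conv_rhs => rw [← h.work x]
  have key : ∀ x, localWake (peeling T D) mem e x =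
      ((woken D (fun v => (mem v).out) e).toConfig.mem x,
        (woken D (fun v => (mem v).out) e).toConfig.sent x) := by
    intro x
    have hx := h.card_le x
    have herase : ∀ w, ((mem x).out.erase w).card ≤ D := fun w => Finset.card_erase_le.trans hx
    have hw := h.work x
    cases e with
    | insertVertex v =>
      by_cases hxv : x = v
      · simp [localWake, Update.event, resetMem, peeling, Snapshot.toConfig, woken, wokenOut, hxv,
          Memory.blank]
      · simp [localWake, Update.event, resetMem, Snapshot.toConfig, woken, wokenOut, hxv,
          not_lt.2 hx, ← hmem x]
    | deleteVertex v =>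
      by_cases hxv : x = v
      · subst hxv
        simp [localWake, Update.event, resetMem, peeling, Snapshot.toConfig, woken, wokenOut,
          not_lt.2 hx, ← hmem x]
      · simp [localWake, Update.event, resetMem, Snapshot.toConfig, woken, wokenOut, hxv,
          not_lt.2 hx, ← hmem x]
    | deleteEdge u v =>
      by_cases hxu : x = u
      · subst hxu
        simp [localWake, Update.event, resetMem, peeling, Snapshot.toConfig, woken, wokenOut,
          not_lt.2 (herase _), hw]
      · by_cases hxv : x = v
        · subst hxv
          simp [localWake, Update.event, resetMem, peeling, Snapshot.toConfig, woken, wokenOut, hxu,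
            not_lt.2 (herase _), hw]
        · simp [localWake, Update.event, resetMem, Snapshot.toConfig, woken, wokenOut, hxv, hxu,
            not_lt.2 hx, ← hmem x]
    | insertEdge u v =>
      obtain ⟨-, -, huv, -⟩ := he
      rcases lt_or_gt_of_ne huv with hlt | hlt
      · have h1 : min u v = u := min_eq_left hlt.le
        have h2 : max u v = v := max_eq_right hlt.le
        by_cases hxu : x = u
        · subst hxu
          simp [localWake, Update.event, resetMem, peeling, Snapshot.toConfig, woken, wokenOut,
            h1, h2, hlt, hw]
        · by_cases hxv : x = v
          · subst hxv
            simp [localWake, Update.event, resetMem, peeling, Snapshot.toConfig, woken, wokenOut,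
              hxu, h1, h2, not_lt.2 (herase _), not_lt.2 hlt.le, hw]
          · simp [localWake, Update.event, resetMem, Snapshot.toConfig, woken, wokenOut, hxv, hxu,
              h1, h2, not_lt.2 hx, ← hmem x]
      · have h1 : min u v = v := min_eq_right hlt.le
        have h2 : max u v = u := max_eq_left hlt.le
        by_cases hxv : x = v
        · subst hxv
          simp [localWake, Update.event, resetMem, peeling, Snapshot.toConfig, woken, wokenOut,
            h1, h2, hlt, hw, huv.symm]
        · by_cases hxu : x = u
          · subst hxu
            simp [localWake, Update.event, resetMem, peeling, Snapshot.toConfig, woken, wokenOut,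
              huv, h1, h2, not_lt.2 (herase _), not_lt.2 hlt.le, hw]
          · simp [localWake, Update.event, resetMem, Snapshot.toConfig, woken, wokenOut, hxv, hxu,
              h1, h2, not_lt.2 hx, ← hmem x]
  unfold start
  simp only [key]

theorem mem_verts_of_card_lt (he : e.Legal G) {out : ℕ → Finset ℕ}
    (h : ∀ v, (out v).card ≤ D) {x : ℕ} (hx : D < (wokenOut out e x).card) :
    x ∈ (duringUpdate G e).verts := by
  have h1 := h x
  cases e with
  | insertVertex v =>
    simp only [wokenOut] at hx
    split_ifs at hx
    · simp at hx
    · omega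
  | deleteVertex v => simp only [wokenOut] at hx; omega
  | insertEdge u v =>
    simp only [wokenOut] at hx
    split_ifs at hx with h2 h3
    · subst h2
      rcases min_choice u v with h | h <;> rw [h]
      · exact he.1
      · exact he.2.1
    · have := Finset.card_erase_le (s := out x) (a := min u v); omega
    · omega
  | deleteEdge u v =>
    simp only [wokenOut] at hx
    have h2 := Finset.card_erase_le (s := out x) (a := u)
    have h3 := Finset.card_erase_le (s := out x) (a := v)
    split_ifs at hx <;> omega

theorem valid_woken (hG : G.WellFormed) (he : e.Legal G) (hT : 1 ≤ T)
    (hN : ∀ v ∈ G.verts, v < N) (h : Ready N D G mem) :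
    (woken D (fun v => (mem v).out) e).Valid (duringUpdate G e) T D N := by
  refine ⟨fun x hx => ?_, fun x hx => ?_, fun x hx => ?_, fun x => ?_, ?_, ?_⟩
  · simp only [woken, decide_eq_true_eq] at hx
    exact mem_verts_of_card_lt he h.card_le hx
  · simp only [woken, decide_eq_true_eq] at hx
    exact Finset.card_pos.1 ((Nat.zero_le _).trans_lt hx)
  · simp only [woken, decide_eq_false_iff_not, not_lt] at hx
    exact hx
  · exact (wokenOut_card_le h.card_le x).trans (by omega)
  · intro a b hab
    have ho := h.orients a b
    simp only [woken]
    cases e with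
    | insertVertex v =>
      have hab' : G.Adj a b := hab
      obtain ⟨h1, h2, -⟩ := hG a b hab'
      have hav : a ≠ v := fun hh => he (hh ▸ h1)
      have hbv : b ≠ v := fun hh => he (hh ▸ h2)
      simpa [wokenOut, hav, hbv] using ho hab'
    | deleteVertex v => exact ho hab
    | insertEdge u v =>
      obtain ⟨-, -, huv, hnew⟩ := he
      rw [mem_wokenOut_insertEdge huv, mem_wokenOut_insertEdge huv]
      simp only [duringUpdate, Network.Adj, Network.apply, Finset.mem_insert, Sym2.eq_iff] at hab
      have h5 : ¬ G.Adj v u := fun hh => hnew hh.symm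
      have ho' : s(a, b) ∈ G.links → _ := ho
      have hnew' : s(u, v) ∉ G.links := hnew
      have h5' : s(v, u) ∉ G.links := h5
      unfold Xor at *
      rcases lt_or_gt_of_ne huv with hlt | hlt
      · rw [min_eq_left hlt.le, max_eq_right hlt.le]
        grind
      · rw [min_eq_right hlt.le, max_eq_left hlt.le]
        grind
    | deleteEdge u v =>
      simp only [duringUpdate, Network.Adj, Network.apply, Finset.mem_erase, ne_eq, Sym2.eq_iff]
        at hab
      have ho' := ho hab.2
      simp only [wokenOut]
      unfold Xor at *
      grind
  · intro x w hw
    have h1 := h.lt x w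
    simp only [woken] at hw
    cases e with
    | insertVertex v =>
      simp only [wokenOut] at hw
      split_ifs at hw
      · simp at hw
      · exact h1 hw
    | deleteVertex v => exact h1 hw
    | insertEdge u v =>
      rcases (mem_wokenOut_insertEdge he.2.2.1).1 hw with hh | hh
      · rw [hh.2]; exact max_lt (hN u he.1) (hN v he.2.1)
      · exact h1 hh.1
    | deleteEdge u v =>
      simp only [wokenOut] at hw
      split_ifs at hw
      · exact h1 (Finset.mem_of_mem_erase hw)
      · exact h1 (Finset.mem_of_mem_erase hw)
      · exact h1 hw

/-! ### The potential between updates -/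

/-- The number of entries that are outdated or disagree with the orientation `o`, plus the number of
links. -/
def debt (G : Network) (o : ℕ → Finset ℕ) (out : ℕ → Finset ℕ) : ℕ :=
  ∑ v ∈ G.verts, (Snapshot.bad G o v (out v)).card + G.links.card

theorem card_links_apply (e : Update) :
    (G.apply e).links.card + (G.links \ (G.apply e).links).card ≤ G.links.card + 1 := by
  have h1 : ((G.apply e).links \ G.links).card ≤ 1 := by
    rw [Finset.card_le_one]
    intro a ha b hb
    cases e <;> simp only [Network.apply, Finset.mem_sdiff, Finset.mem_insert, Finset.mem_filter,
      Finset.mem_erase] at ha hb <;> grind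
  have h2 := Finset.card_sdiff_add_card_inter (G.apply e).links G.links
  have h3 := Finset.card_sdiff_add_card_inter G.links (G.apply e).links
  rw [Finset.inter_comm] at h3
  omega

/-- Only the insertion of an edge creates an entry, and only one; in the other cases `(0, 0)` is a
placeholder. -/
theorem wokenOut_new {out : ℕ → Finset ℕ} (he : e.Legal G) :
    ∃ p : ℕ × ℕ, ∀ v ∈ (G.apply e).verts, ∀ w ∈ wokenOut out e v,
      (v, w) = p ∨ (v ∈ G.verts ∧ w ∈ out v) := by
  cases e with
  | insertVertex u =>
    refine ⟨(0, 0), fun v hv w hw => Or.inr ?_⟩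
    simp only [wokenOut, Network.apply, Finset.mem_insert] at hw hv
    split_ifs at hw with h
    · simp at hw
    · exact ⟨hv.resolve_left h, hw⟩
  | deleteVertex u =>
    exact ⟨(0, 0), fun v hv w hw => Or.inr ⟨Finset.mem_of_mem_erase hv, hw⟩⟩
  | insertEdge a b =>
    refine ⟨(min a b, max a b), fun v hv w hw => ?_⟩
    rcases (mem_wokenOut_insertEdge he.2.2.1).1 hw with hh | hh
    · exact Or.inl (Prod.ext hh.1 hh.2)
    · exact Or.inr ⟨hv, hh.1⟩
  | deleteEdge a b =>
    refine ⟨(0, 0), fun v hv w hw => Or.inr ⟨hv, ?_⟩⟩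
    simp only [wokenOut] at hw
    split_ifs at hw
    · exact Finset.mem_of_mem_erase hw
    · exact Finset.mem_of_mem_erase hw
    · exact hw

/-- A bad entry after the update is new, was bad already, was flipped by the reference, or was good
on a link that is now gone. The entries of the last kind are offset by the loss of links. The
summand 2 stands for one new entry and one new link. -/
theorem debt_wokenOut_le {δ : ℕ} {o o' out : ℕ → Finset ℕ} (hG : G.WellFormed) (he : e.Legal G)
    (ho : IsOrientation δ G o) :
    debt (G.apply e) o' (wokenOut out e) ≤ debt G o out + flips G (G.apply e) o o' + 2 := by
  obtain ⟨p, hp⟩ := wokenOut_new (out := out) he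
  have hlinks := card_links_apply (G := G) e
  generalize G.apply e = G' at *
  obtain ⟨L, hL⟩ : ∃ L, L = (G.verts ×ˢ G.verts).filter fun q : ℕ × ℕ =>
    G.Adj q.1 q.2 ∧ ¬ G'.Adj q.1 q.2 ∧ q.2 ∈ o q.1 := ⟨_, rfl⟩
  have hLc : L.card ≤ (G.links \ G'.links).card := by
    refine card_le_card_links (fun q hq => ?_) (fun q hq hq' => ?_)
    · have := (Finset.mem_filter.1 (hL ▸ hq)).2
      exact Finset.mem_sdiff.2 ⟨this.1, this.2.1⟩
    · have h1 := (Finset.mem_filter.1 (hL ▸ hq)).2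
      have h2 := (Finset.mem_filter.1 (hL ▸ hq')).2.2.2
      rcases ho.1 _ _ h1.1 with hh | hh
      · exact hh.2 h2
      · exact hh.2 h1.2.2
  have hmain : ∑ v ∈ G'.verts, (Snapshot.bad G' o' v (wokenOut out e v)).card ≤
      ∑ v ∈ G.verts, (Snapshot.bad G o v (out v)).card + flips G G' o o' + L.card + 1 := by
    unfold flips
    rw [← Finset.card_sigma, ← Finset.card_sigma,
      ← Finset.card_map (Equiv.sigmaEquivProd ℕ ℕ).toEmbedding,
      ← Finset.card_map (Equiv.sigmaEquivProd ℕ ℕ).toEmbedding, ← Finset.card_singleton p]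
    refine le_trans (Finset.card_le_card ?_) ((Finset.card_union_le _ _).trans
      (Nat.add_le_add_right ((Finset.card_union_le _ _).trans
        (Nat.add_le_add_right (Finset.card_union_le _ _) _)) _))
    rintro ⟨x, y⟩ hq
    simp only [Finset.mem_map_equiv, Finset.mem_sigma, Equiv.sigmaEquivProd_symm_apply,
      Snapshot.bad, Finset.mem_filter] at hq
    simp only [Finset.mem_union, Finset.mem_map_equiv, Finset.mem_sigma,
      Equiv.sigmaEquivProd_symm_apply, Snapshot.bad, Finset.mem_filter, hL, Finset.mem_product,
      Finset.mem_singleton]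
    rcases hp x hq.1 y hq.2.1 with h | ⟨h1, h2⟩
    · exact Or.inr h
    · refine Or.inl ?_
      by_cases h4 : y ∈ o x ∧ G.Adj x y
      · have h5 := (hG x y h4.2).2.1
        by_cases h6 : G'.Adj x y
        · exact Or.inl (Or.inr ⟨⟨h1, h5⟩, h4.2, h6, h4.1, fun h7 => hq.2.2 ⟨h7, h6⟩⟩)
        · exact Or.inr ⟨⟨h1, h5⟩, h4.2, h6, h4.1⟩
      · exact Or.inl (Or.inl ⟨h1, h2, h4⟩)
  unfold debt
  omega

theorem potential_woken_le {δ : ℕ} {H : Network} {o out : ℕ → Finset ℕ}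
    (ho : IsOrientation δ H o) (hD : 4 * δ + 2 * T ≤ D) :
    (woken D out e).potential H T o + 2 * H.links.card ≤ 2 * debt H o (wokenOut out e) := by
  have : (woken D out e).potential H T o ≤
      ∑ v ∈ H.verts, 2 * (Snapshot.bad H o v (wokenOut out e v)).card := by
    refine Finset.sum_le_sum fun v hv => ?_
    split_ifs with hoff
    · simp only [woken, decide_eq_true_eq] at hoff
      exact Snapshot.offering_le_idle ho hv hD hoff
    · exact le_rfl
  rw [← Finset.mul_sum] at this
  unfold debt
  omega

theorem potential_of_idle {H : Network} {st : Snapshot} {o : ℕ → Finset ℕ}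
    (h : ∀ v, st.off v = false) :
    st.potential H T o + 2 * H.links.card = 2 * debt H o st.out := by
  simp only [Snapshot.potential, h, Bool.false_eq_true, if_false, ← Finset.mul_sum, debt, mul_add]

theorem duringUpdate_eq_or (G : Network) (e : Update) :
    duringUpdate G e = G.apply e ∨ (duringUpdate G e = G ∧ ∃ v, e = .deleteVertex v) := by
  cases e <;> simp [duringUpdate]

/-- The bounds on the procedure for a single update. -/
theorem exists_quiet {α δ : ℕ} {o o' : ℕ → Finset ℕ} (hG : G.WellFormed) (he : e.Legal G)
    (hα1 : 1 ≤ α) (hα' : (G.apply e).arboricity ≤ α) (hN : ∀ v ∈ G.verts, v < N)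
    (hN' : ∀ v ∈ (G.apply e).verts, v < N) (ho : IsOrientation δ G o)
    (ho' : IsOrientation δ (G.apply e) o') (hD : 4 * δ + 8 * α ≤ D) (h : Ready N D G mem) :
    ∃ K, Quiet (peeling (4 * α) D) (duringUpdate G e)
        (configAfter (peeling (4 * α) D) G mem e K) ∧
      Ready N D (G.apply e) (configAfter (peeling (4 * α) D) G mem e K).mem ∧
      ∑ k ∈ Finset.range K, sentCount (duringUpdate G e)
          (configAfter (peeling (4 * α) D) G mem e k) +
        12 * debt (G.apply e) o' (fun v =>
          ((configAfter (peeling (4 * α) D) G mem e K).mem v).out) ≤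
        12 * (debt G o (fun v => (mem v).out) + flips G (G.apply e) o o' + 2) ∧
      K + 12 * debt (G.apply e) o' (fun v =>
          ((configAfter (peeling (4 * α) D) G mem e K).mem v).out) ≤
        12 * (debt G o (fun v => (mem v).out) + flips G (G.apply e) o o' + 2) := by
  have hv := valid_woken (T := 4 * α) hG he (by omega) hN h
  have hs := start_peeling (T := 4 * α) he h
  have hdebt := debt_wokenOut_le (o' := o') (out := fun v => (mem v).out) hG he ho
  unfold configAfter
  rw [hs]
  rcases duringUpdate_eq_or G e with hH | ⟨hH, v, rfl⟩
  · rw [hH] at hv ⊢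
    have hG' := hG.apply he
    obtain ⟨j, h1, h2, h3⟩ := exists_idle hG' hα' hN' ho' hD hv
    have hvj := hv.iterate hG' (by omega) hN' j
    have h4 := potential_woken_le (e := e) (T := 4 * α) (D := D)
      (out := fun v => (mem v).out) ho' (by omega)
    have h5 := potential_of_idle (H := G.apply e) (T := 4 * α) (o := o') h1
    have h6 : debt (G.apply e) o' (fun v => (((Snapshot.next (G.apply e) (4 * α) D)^[j]
        (woken D (fun v => (mem v).out) e)).toConfig.mem v).out) = debt (G.apply e) o'
        ((Snapshot.next (G.apply e) (4 * α) D)^[j] (woken D (fun v => (mem v).out) e)).out := rfl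
    refine ⟨2 * j, ?_⟩
    rw [iterate_even hG' (by omega) hN' hv]
    refine ⟨quiet_toConfig h1, ⟨fun v => ?_, fun v => hvj.idle_card v (h1 v), hvj.lt, hvj.orients⟩,
      ?_, ?_⟩
    · simp [Snapshot.toConfig, h1 v]
    · rw [h6]
      omega
    · rw [h6]
      omega
  -- When a vertex is deleted no list grows, so nobody offers and the procedure is over after zero
  -- rounds. Entries naming the departed vertex stay behind as outdated ones.
  · rw [hH] at hv ⊢
    have hidle : ∀ x, (woken D (fun v => (mem v).out) (.deleteVertex v)).off x = false :=
      fun x => decide_eq_false (not_lt.2 (h.card_le x))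
    refine ⟨0, quiet_toConfig hidle, ⟨fun v => ?_, fun v => hv.idle_card v (hidle v), hv.lt, ?_⟩,
      ?_, ?_⟩
    · simp [Snapshot.toConfig, hidle v]
    · intro a b hab
      refine hv.orients a b ?_
      exact (Finset.mem_filter.1 hab).1
    · simpa [Snapshot.toConfig, woken] using Nat.mul_le_mul_left 12 hdebt
    · simpa [Snapshot.toConfig, woken] using Nat.mul_le_mul_left 12 hdebt

/-! ### Sequences of updates -/

variable {α t : ℕ} {σ : ℕ → Update}

/-- Termination requires some reference orientation; the `2 * α`-orientations serve here, and `4 *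
(2 * α) + 8 * α = 16 * α` is the resulting condition on `D`. -/
theorem ready_memAt (hα1 : 1 ≤ α) (hD : 16 * α ≤ D) (hσ : ArboricityPreserving α N σ t) :
    ∀ i ≤ t, Ready N D (graphAt σ i) (memAt (peeling (4 * α) D) σ i) ∧
      ∀ k < i, TerminatesAt (peeling (4 * α) D) σ k := by
  obtain ⟨o, ho, -⟩ := exists_orientations hα1 hσ
  intro i
  induction i with
  | zero =>
    intro _
    refine ⟨⟨fun v => rfl, fun v => by simp [memAt, Memory.blank],
      fun v w hw => by simp [memAt, Memory.blank] at hw, fun u v huv => ?_⟩, fun k hk => by omega⟩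
    simp [graphAt, Network.empty, Network.Adj] at huv
  | succ i ih =>
    intro hi
    obtain ⟨h1, h2⟩ := ih (by omega)
    obtain ⟨K, h3, h4, -⟩ := exists_quiet (wellFormed_graphAt hσ.legal i (by omega))
      (hσ.legal i hi) hα1 (hσ.arboricity_le (i + 1) hi) (hσ.id_lt i (by omega))
      (hσ.id_lt (i + 1) hi) (ho i (by omega)) (ho (i + 1) hi) (by omega) h1
    refine ⟨?_, fun k hk => ?_⟩
    · rw [← configAfter_duration_mem h3] at h4
      exact h4
    · rcases Nat.lt_succ_iff_lt_or_eq.1 hk with hk | rfl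
      · exact h2 k hk
      · exact ⟨K, h3⟩

/-- The single-update bounds telescope, starting from debt zero. The factor 12 comes from cost at
most 6 per unit of potential and potential 2 per unit of debt. -/
theorem totals_add_debt_le {δ : ℕ} {o : ℕ → ℕ → Finset ℕ} (hα1 : 1 ≤ α) (hD : 16 * α ≤ D)
    (hδ : 16 * δ ≤ D) (hσ : ArboricityPreserving α N σ t)
    (ho : ∀ i ≤ t, IsOrientation δ (graphAt σ i) (o i)) : ∀ i ≤ t,
    totalMessages (peeling (4 * α) D) σ i +
        12 * debt (graphAt σ i) (o i) (outAt (peeling (4 * α) D) σ i) ≤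
      12 * totalFlips σ o i + 24 * i ∧
    totalRounds (peeling (4 * α) D) σ i +
        12 * debt (graphAt σ i) (o i) (outAt (peeling (4 * α) D) σ i) ≤
      12 * totalFlips σ o i + 24 * i := by
  intro i
  induction i with
  | zero =>
    intro _
    simp [totalMessages, totalRounds, totalFlips, debt, graphAt, Network.empty]
  | succ i ih =>
    intro hi
    obtain ⟨h1, h2⟩ := ih (by omega)
    obtain ⟨K, h3, -, h5, h6⟩ := exists_quiet (wellFormed_graphAt hσ.legal i (by omega))
      (hσ.legal i hi) hα1 (hσ.arboricity_le (i + 1) hi) (hσ.id_lt i (by omega))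
      (hσ.id_lt (i + 1) hi) (ho i (by omega)) (ho (i + 1) hi) (by omega)
      (ready_memAt hα1 hD hσ i (by omega)).1
    rw [← configAfter_duration_mem h3] at h5 h6
    have hK : roundsAt (peeling (4 * α) D) σ i ≤ K := duration_le h3
    have hM : messagesAt (peeling (4 * α) D) σ i ≤ _ := Finset.sum_le_sum_of_subset
      (Finset.range_mono hK)
    have e1 : debt ((graphAt σ i).apply (σ i)) (o (i + 1)) (fun v =>
        ((configAfter (peeling (4 * α) D) (graphAt σ i) (memAt (peeling (4 * α) D) σ i) (σ i)
          (duration (peeling (4 * α) D) (graphAt σ i) (memAt (peeling (4 * α) D) σ i) (σ i))).mem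
            v).out) =
        debt (graphAt σ (i + 1)) (o (i + 1)) (outAt (peeling (4 * α) D) σ (i + 1)) := rfl
    have e2 : debt (graphAt σ i) (o i) (fun v => (memAt (peeling (4 * α) D) σ i v).out) =
        debt (graphAt σ i) (o i) (outAt (peeling (4 * α) D) σ i) := rfl
    have e3 : flips (graphAt σ i) ((graphAt σ i).apply (σ i)) (o i) (o (i + 1)) =
        flips (graphAt σ i) (graphAt σ (i + 1)) (o i) (o (i + 1)) := rfl
    rw [e1, e2, e3] at h5 h6
    simp only [totalMessages, totalRounds, totalFlips, Finset.sum_range_succ] at h1 h2 ⊢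
    simp only [netDuring, configAt] at hM
    omega

theorem totals_le {δ : ℕ} {o : ℕ → ℕ → Finset ℕ} (hα1 : 1 ≤ α) (hD : 16 * α ≤ D)
    (hδ : 16 * δ ≤ D) (hσ : ArboricityPreserving α N σ t)
    (ho : ∀ i ≤ t, IsOrientation δ (graphAt σ i) (o i)) :
    totalMessages (peeling (4 * α) D) σ t ≤ 24 * (t + totalFlips σ o t) ∧
      totalRounds (peeling (4 * α) D) σ t ≤ 24 * (t + totalFlips σ o t) := by
  have := totals_add_debt_le hα1 hD hδ hσ ho t le_rfl
  omega

theorem maintains_peeling (hα1 : 1 ≤ α) (hD : 16 * α ≤ D) (hσ : ArboricityPreserving α N σ t) :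
    Maintains (peeling (4 * α) D) D σ t := by
  have h := ready_memAt hα1 hD hσ
  refine ⟨(h t le_rfl).2, fun i hi => ⟨(h i hi).1.orients, fun v _ => ?_⟩⟩
  exact (Finset.card_filter_le _ _).trans ((h i hi).1.card_le v)

/-- All configurations that occur arise from snapshots that satisfy the invariants. -/
theorem configAt_peeling (hα1 : 1 ≤ α) (hD : 16 * α ≤ D) (hσ : ArboricityPreserving α N σ t)
    {i : ℕ} (hi : i < t) (k : ℕ) :
    ∃ st : Snapshot, st.Valid (netDuring σ i) (4 * α) D N ∧
      (configAt (peeling (4 * α) D) σ i k = st.toConfig ∨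
        configAt (peeling (4 * α) D) σ i k = st.midConfig (netDuring σ i) (4 * α) D) := by
  have hr := (ready_memAt hα1 hD hσ i hi.le).1
  have hG := wellFormed_graphAt hσ.legal i hi.le
  have he := hσ.legal i hi
  have hv := valid_woken (T := 4 * α) hG he (by omega) (hσ.id_lt i hi.le) hr
  have hH : (netDuring σ i).WellFormed ∧ ∀ v ∈ (netDuring σ i).verts, v < N := by
    unfold netDuring
    rcases duringUpdate_eq_or (graphAt σ i) (σ i) with hH | ⟨hH, -⟩
    · rw [hH]; exact ⟨hG.apply he, hσ.id_lt (i + 1) hi⟩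
    · rw [hH]; exact ⟨hG, hσ.id_lt i hi.le⟩
  unfold configAt configAfter
  rw [start_peeling he hr]
  rcases Nat.even_or_odd' k with ⟨j, rfl | rfl⟩
  · exact ⟨_, hv.iterate hH.1 (by omega) hH.2 j, Or.inl (iterate_even hH.1 (by omega) hH.2 hv j)⟩
  · exact ⟨_, hv.iterate hH.1 (by omega) hH.2 j, Or.inr (iterate_odd hH.1 (by omega) hH.2 hv j)⟩

theorem memoryAtMost_peeling (hα1 : 1 ≤ α) (hD : 16 * α ≤ D)
    (hσ : ArboricityPreserving α N σ t) : MemoryAtMost (peeling (4 * α) D) (2 * D) σ t := by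
  intro i hi k v _
  obtain ⟨st, hst, h | h⟩ := configAt_peeling hα1 hD hσ hi k
  · rw [h]; exact (size_toConfig_le hst v).trans (by omega)
  · rw [h]; exact (size_midConfig_le hst v).trans (by omega)

theorem size_le_two_mul_log {w N : ℕ} (h : w < N) : Nat.size w ≤ 2 * Nat.log 2 (N + 2) := by
  have h1 : 1 ≤ Nat.log 2 (N + 2) := Nat.log_pos (by norm_num) (by omega)
  have h2 : Nat.size w ≤ Nat.log 2 (N + 2) + 1 :=
    Nat.size_le.2 ((h.trans (by omega)).trans (Nat.lt_pow_succ_log_self (by norm_num) (N + 2)))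
  omega

theorem wordsAtMost_peeling (hα1 : 1 ≤ α) (hD : 16 * α ≤ D)
    (hσ : ArboricityPreserving α N σ t) :
    WordsAtMost (peeling (4 * α) D) (2 * Nat.log 2 (N + 2)) σ t := by
  intro i hi k v _
  have hb : 1 ≤ Nat.log 2 (N + 2) := Nat.log_pos (by norm_num) (by omega)
  have hN : ∀ v ∈ (netDuring σ i).verts, v < N := by
    unfold netDuring
    rcases duringUpdate_eq_or (graphAt σ i) (σ i) with hH | ⟨hH, -⟩
    · rw [hH]; exact hσ.id_lt (i + 1) hi
    · rw [hH]; exact hσ.id_lt i hi.le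
  obtain ⟨st, hst, h | h⟩ := configAt_peeling hα1 hD hσ hi k
  · rw [h]; exact fitsIn_toConfig (by omega) (fun w hw => size_le_two_mul_log hw) hst v
  · rw [h]; exact fitsIn_midConfig (by omega) (fun w hw => size_le_two_mul_log hw) hN hst v

/-! ### The logarithmic amortized cost. -/

theorem sum_log_le (n : ℕ → ℕ) (t : ℕ) :
    ((t + ∑ i ∈ Finset.range t, Nat.log 2 (n i) : ℕ) : ℝ) ≤
      2 * ∑ i ∈ Finset.range t, Real.logb 2 ((n i : ℝ) + 2) := by
  have h : ∀ i, ((1 + Nat.log 2 (n i) : ℕ) : ℝ) ≤ 2 * Real.logb 2 ((n i : ℝ) + 2) := by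
    intro i
    -- The 2 added to the argument makes every logarithm at least 1, which absorbs the constant cost
    -- per update.
    have h1 : (1 : ℝ) ≤ Real.logb 2 ((n i : ℝ) + 2) := by
      rw [Real.le_logb_iff_rpow_le (by norm_num) (by positivity)]
      have : (0 : ℝ) ≤ n i := Nat.cast_nonneg _
      simp only [Real.rpow_one]
      linarith
    have h2 : (Nat.log 2 (n i) : ℝ) ≤ Real.logb 2 ((n i : ℝ) + 2) := by
      have ha : Nat.log 2 (n i) ≤ Nat.log 2 (n i + 2) := Nat.log_mono_right (by omega)
      have hb := Real.natLog_le_logb (n i + 2) 2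
      push_cast at hb
      exact le_trans (by exact_mod_cast ha) hb
    push_cast
    linarith
  have hs := Finset.sum_le_sum fun i (_ : i ∈ Finset.range t) => h i
  rw [← Finset.mul_sum, ← Nat.cast_sum, Finset.sum_add_distrib] at hs
  simpa using hs

/-- With `δ = 2 * α` the condition `16 * δ ≤ D` becomes `32 * α ≤ D`; the factor is 24 from
`totals_le` times 2 from `sum_log_le`. -/
theorem totals_le_log (hα1 : 1 ≤ α) (hD : 32 * α ≤ D) (hσ : ArboricityPreserving α N σ t) :
    (totalMessages (peeling (4 * α) D) σ t : ℝ) ≤ 48 * ∑ i ∈ Finset.range t,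
        Real.logb 2 (((graphAt σ (i + 1)).verts.card : ℝ) + 2) ∧
      (totalRounds (peeling (4 * α) D) σ t : ℝ) ≤ 48 * ∑ i ∈ Finset.range t,
        Real.logb 2 (((graphAt σ (i + 1)).verts.card : ℝ) + 2) := by
  obtain ⟨o, ho, hf⟩ := exists_orientations hα1 hσ
  obtain ⟨h1, h2⟩ := totals_le (D := D) hα1 (by omega) (by omega) hσ ho
  have h3 := sum_log_le (fun i => (graphAt σ (i + 1)).verts.card) t
  have key : ∀ x : ℕ, x ≤ 24 * (t + totalFlips σ o t) → (x : ℝ) ≤ 48 * ∑ i ∈ Finset.range t,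
      Real.logb 2 (((graphAt σ (i + 1)).verts.card : ℝ) + 2) := by
    intro x hx
    have h4 : x ≤ 24 * (t + ∑ i ∈ Finset.range t, Nat.log 2 (graphAt σ (i + 1)).verts.card) := by
      omega
    have h5 : (x : ℝ) ≤ 24 * ((t + ∑ i ∈ Finset.range t,
        Nat.log 2 (graphAt σ (i + 1)).verts.card : ℕ) : ℝ) := by exact_mod_cast h4
    linarith
  exact ⟨key _ h1, key _ h2⟩

end

/-! ### The memory lower bound -/

/-- A well-formed graph with at most `2 * α` vertices has arboricity at most `α`. -/
theorem arboricity_le_of_card_le {G : Network} (hG : G.WellFormed) {α : ℕ}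
    (h : G.verts.card ≤ 2 * α) : G.arboricity ≤ α := by
  refine Finset.sup_le fun U hU => ?_
  obtain ⟨hU, h2⟩ := Finset.mem_filter.1 hU
  have hUc : U.card ≤ 2 * α := (Finset.card_le_card (Finset.mem_powerset.1 hU)).trans h
  have hsub : (G.linksIn U).card ≤ U.card.choose 2 := by
    have : G.linksIn U ⊆ U.offDiag.image Sym2.mk.uncurry := by
      intro e
      induction e with
      | _ x y =>
        intro he
        simp only [Network.linksIn, Finset.mem_inter, Finset.mk_mem_sym2_iff] at he
        exact Finset.mem_image.2
          ⟨(x, y), Finset.mem_offDiag.2 ⟨he.2.1, he.2.2, (hG x y he.1).2.2⟩, rfl⟩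
    refine (Finset.card_le_card this).trans ?_
    exact (Sym2.card_image_offDiag U).le
  have hc : (2 : ℚ) ≤ U.card := by exact_mod_cast h2
  have h3 : ((G.linksIn U).card : ℚ) ≤ (U.card : ℚ) * ((U.card : ℚ) - 1) / 2 := by
    rw [← Nat.cast_choose_two]
    exact_mod_cast hsub
  have h4 : (U.card : ℚ) ≤ 2 * α := by exact_mod_cast hUc
  -- Even a complete graph on `U` has density only `|U| / 2 ≤ α`.
  refine Nat.ceil_le.2 ?_
  rw [div_le_iff₀ (by linarith)]
  nlinarith

/-- The updates in a list, in order. -/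
def runList (G : Network) (l : List Update) : Network := l.foldl Network.apply G

/-- All updates in a list are legal when they take place. -/
def LegalList : Network → List Update → Prop
  | _, [] => True
  | G, e :: l => e.Legal G ∧ LegalList (G.apply e) l

theorem runList_append (G : Network) (l l' : List Update) :
    runList G (l ++ l') = runList (runList G l) l' := List.foldl_append

theorem LegalList.append {G : Network} {l l' : List Update} (h : LegalList G l)
    (h' : LegalList (runList G l) l') : LegalList G (l ++ l') := by
  induction l generalizing G with
  | nil => exact h'
  | cons e l ih => exact ⟨h.1, ih h.2 h'⟩

/-- Vertices `0, …, n - 1` are inserted into the empty graph. -/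
theorem exists_insert_vertices (n : ℕ) :
    ∃ l, LegalList Network.empty l ∧ runList Network.empty l = ⟨Finset.range n, ∅⟩ ∧
      ∀ l', l' <+: l → (runList Network.empty l').verts ⊆ Finset.range n := by
  induction n with
  | zero =>
    refine ⟨[], trivial, rfl, fun l' hl' => ?_⟩
    rw [List.prefix_nil.1 hl']
    exact subset_rfl
  | succ n ih =>
    obtain ⟨l, h1, h2, h3⟩ := ih
    have hrun : runList Network.empty (l ++ [.insertVertex n]) = ⟨Finset.range (n + 1), ∅⟩ := by
      rw [runList_append, h2]
      simp [runList, Network.apply, Finset.range_add_one]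
    refine ⟨l ++ [.insertVertex n], h1.append ?_, hrun, fun l' hl' => ?_⟩
    · rw [h2]
      exact ⟨by simp [Update.Legal], trivial⟩
    · rcases List.prefix_concat_iff.1 hl' with rfl | hl'
      · rw [hrun]
      · exact (h3 l' hl').trans (Finset.range_mono (Nat.le_succ n))

/-- All edges of a loopless set of pairs of present vertices can be inserted one after the other. -/
theorem exists_insert_edges (V : Finset ℕ) (E : Finset (Sym2 ℕ)) :
    (∀ x y, s(x, y) ∈ E → x ∈ V ∧ y ∈ V ∧ x ≠ y) →
    ∃ l, LegalList ⟨V, ∅⟩ l ∧ runList ⟨V, ∅⟩ l = ⟨V, E⟩ ∧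
      ∀ l', l' <+: l → (runList ⟨V, ∅⟩ l').verts = V := by
  induction E using Finset.induction_on with
  | empty =>
    intro _
    refine ⟨[], trivial, rfl, fun l' hl' => ?_⟩
    rw [List.prefix_nil.1 hl']
    rfl
  | insert e E he ih =>
    intro hE
    obtain ⟨l, h1, h2, h3⟩ := ih fun x y h => hE x y (Finset.mem_insert_of_mem h)
    induction e with
    | _ x y =>
      obtain ⟨hx, hy, hxy⟩ := hE x y (Finset.mem_insert_self _ _)
      have hrun : runList ⟨V, ∅⟩ (l ++ [.insertEdge x y]) = ⟨V, insert s(x, y) E⟩ := by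
        rw [runList_append, h2]
        rfl
      refine ⟨l ++ [.insertEdge x y], h1.append ?_, hrun, fun l' hl' => ?_⟩
      · rw [h2]
        exact ⟨⟨hx, hy, hxy, he⟩, trivial⟩
      · rcases List.prefix_concat_iff.1 hl' with rfl | hl'
        · rw [hrun]
        · exact h3 l' hl'

/-- The sequence of updates given by a list (with an arbitrary continuation). -/
def sequenceOf (l : List Update) (i : ℕ) : Update := l.getD i (.insertVertex 0)

theorem graphAt_sequenceOf (l : List Update) :
    ∀ i ≤ l.length, graphAt (sequenceOf l) i = runList Network.empty (l.take i) := by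
  intro i
  induction i with
  | zero => intro _; simp [graphAt, runList]
  | succ i ih =>
    intro hi
    rw [graphAt, ih (by omega), List.take_add_one, runList_append,
      List.getElem?_eq_getElem (by omega)]
    simp [runList, sequenceOf, List.getElem?_eq_getElem (show i < l.length by omega)]

theorem LegalList.legal {l : List Update} : ∀ {G : Network}, LegalList G l →
    ∀ i (hi : i < l.length), (l[i]).Legal (runList G (l.take i)) := by
  induction l with
  | nil => intro G _ i hi; simp at hi
  | cons e l ih =>
    intro G h i hi
    cases i with
    | zero => exact h.1
    | succ i => exact ih h.2 i (by simpa using hi)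

theorem LegalList.legal_sequenceOf {l : List Update} (h : LegalList Network.empty l) :
    ∀ i < l.length, (sequenceOf l i).Legal (graphAt (sequenceOf l) i) := by
  intro i hi
  rw [graphAt_sequenceOf l i hi.le]
  simpa [sequenceOf, List.getElem?_eq_getElem hi] using h.legal i hi

/-- The complete graph on `0, …, n - 1`. -/
def completeNetwork (n : ℕ) : Network :=
  ⟨Finset.range n, (Finset.range n).sym2.filter fun e => ¬ e.IsDiag⟩

/-- All graphs on the way have at most `2 * α` vertices, so their arboricity is automatically at
most `α`, whatever the order of the edge insertions. -/
theorem exists_sequence_completeNetwork {α N : ℕ} (hN : 2 * α ≤ N) :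
    ∃ (σ : ℕ → Update) (t : ℕ), ArboricityPreserving α N σ t ∧
      graphAt σ t = completeNetwork (2 * α) := by
  obtain ⟨l₁, h1, h2, h3⟩ := exists_insert_vertices (2 * α)
  obtain ⟨l₂, h4, h5, h6⟩ := exists_insert_edges (Finset.range (2 * α))
    (completeNetwork (2 * α)).links fun x y h => by
      simpa [completeNetwork, Finset.mk_mem_sym2_iff, and_assoc] using h
  have hl : LegalList Network.empty (l₁ ++ l₂) := h1.append (by rw [h2]; exact h4)
  have hverts : ∀ i ≤ (l₁ ++ l₂).length,
      (graphAt (sequenceOf (l₁ ++ l₂)) i).verts ⊆ Finset.range (2 * α) := by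
    intro i hi
    rw [graphAt_sequenceOf _ i hi]
    rcases le_total i l₁.length with hi' | hi'
    · rw [List.take_append_of_le_length hi']
      exact h3 _ (List.take_prefix i l₁)
    · rw [List.take_append, List.take_of_length_le hi', runList_append, h2,
        h6 _ (List.take_prefix _ l₂)]
  have hwf := wellFormed_graphAt hl.legal_sequenceOf
  refine ⟨sequenceOf (l₁ ++ l₂), (l₁ ++ l₂).length, ⟨hl.legal_sequenceOf, fun i hi => ?_,
    fun i hi v hv => ?_⟩, ?_⟩
  · refine arboricity_le_of_card_le (hwf i hi) ?_
    simpa using Finset.card_le_card (hverts i hi)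
  · exact (Finset.mem_range.1 (hverts i hi hv)).trans_le hN
  · rw [graphAt_sequenceOf _ _ le_rfl, List.take_length, runList_append, h2, h5]
    rfl

/-- Some vertex of the complete graph on `2 * α` vertices has outdegree at least `α`. -/
theorem exists_le_card_out {α : ℕ} (hα : 1 ≤ α) {out : ℕ → Finset ℕ}
    (h : Orients (completeNetwork (2 * α)) out) :
    ∃ v ∈ (completeNetwork (2 * α)).verts, α ≤ (out v).card := by
  by_contra! hcon
  have h1 : (completeNetwork (2 * α)).links.card ≤
      ∑ v ∈ Finset.range (2 * α), (out v).card := by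
    rw [← Finset.card_sigma]
    refine (Finset.card_le_card ?_).trans (Finset.card_image_le (f := fun p => s(p.1, p.2)))
    intro e
    induction e with
    | _ x y =>
      intro he
      have hxy : x ∈ Finset.range (2 * α) ∧ y ∈ Finset.range (2 * α) := by
        have := (Finset.mem_filter.1 he).1
        rwa [Finset.mk_mem_sym2_iff] at this
      rcases h x y he with hh | hh
      · exact Finset.mem_image.2 ⟨⟨x, y⟩, Finset.mem_sigma.2 ⟨hxy.1, hh.1⟩, rfl⟩
      · exact Finset.mem_image.2 ⟨⟨y, x⟩, Finset.mem_sigma.2 ⟨hxy.2, hh.1⟩, Sym2.eq_swap⟩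
  have h2 : ∑ v ∈ Finset.range (2 * α), (out v).card ≤ (2 * α) * (α - 1) := by
    have := Finset.sum_le_card_nsmul (Finset.range (2 * α)) (fun v => (out v).card) (α - 1)
      fun v hv => Nat.le_sub_one_of_lt (hcon v hv)
    simpa using this
  have h3 : (completeNetwork (2 * α)).links.card = (2 * α).choose 2 := by
    have : (completeNetwork (2 * α)).links =
        (Finset.range (2 * α)).offDiag.image Sym2.mk.uncurry := by
      ext e
      induction e with
      | _ x y =>
        simp only [completeNetwork, Finset.mem_filter, Finset.mk_mem_sym2_iff,
          Sym2.mk_isDiag_iff, Finset.mem_image, Finset.mem_offDiag, Prod.exists,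
          Function.uncurry_apply_pair,
          Sym2.eq_iff]
        constructor
        · rintro ⟨⟨hx, hy⟩, hxy⟩
          exact ⟨x, y, ⟨hx, hy, hxy⟩, Or.inl ⟨rfl, rfl⟩⟩
        · rintro ⟨a, b, ⟨ha, hb, hab⟩, ⟨rfl, rfl⟩ | ⟨rfl, rfl⟩⟩
          · exact ⟨⟨ha, hb⟩, hab⟩
          · exact ⟨⟨hb, ha⟩, Ne.symm hab⟩
    rw [this, Sym2.card_image_offDiag, Finset.card_range]
  have h4 : (2 * α).choose 2 = α * (2 * α - 1) := by
    rw [Nat.choose_two_right, mul_assoc, Nat.mul_div_cancel_left _ (by norm_num)]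
  -- With `α = 1 + β`, counting edges at their tails would give `(1 + β) * (2 * β + 1) ≤ 2 * (1 + β)
  -- * β`, which is false.
  obtain ⟨β, rfl⟩ := Nat.exists_eq_add_of_le hα
  rw [h3, h4] at h1
  have h5 := h1.trans h2
  rw [show 2 * (1 + β) - 1 = 2 * β + 1 by omega, show 1 + β - 1 = β by omega] at h5
  nlinarith

end DynNet

end

/-! ### Assembly of the upper and lower bounds. -/

theorem mainTheorem1 :
    (∃ c C : ℕ, ∀ α : ℕ, 1 ≤ α → ∀ Δ : ℕ, c * α ≤ Δ →
      ∃ A : DynNet.Protocol, ∀ (N : ℕ) (σ : ℕ → DynNet.Update) (t : ℕ),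
        DynNet.ArboricityPreserving α N σ t →
          DynNet.Maintains A Δ σ t ∧
          DynNet.MemoryAtMost A (C * Δ) σ t ∧
          DynNet.WordsAtMost A (C * Nat.log 2 (N + 2)) σ t ∧
          (∀ (δ : ℕ) (o : ℕ → ℕ → Finset ℕ), c * δ ≤ Δ →
            (∀ i ≤ t, DynNet.IsOrientation δ (DynNet.graphAt σ i) (o i)) →
              DynNet.totalMessages A σ t ≤ C * (t + DynNet.totalFlips σ o t) ∧
              DynNet.totalRounds A σ t ≤ C * (t + DynNet.totalFlips σ o t)) ∧
          (DynNet.totalMessages A σ t : ℝ) ≤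
            C * ∑ i ∈ Finset.range t,
              Real.logb 2 (((DynNet.graphAt σ (i + 1)).verts.card : ℝ) + 2) ∧
          (DynNet.totalRounds A σ t : ℝ) ≤
            C * ∑ i ∈ Finset.range t,
              Real.logb 2 (((DynNet.graphAt σ (i + 1)).verts.card : ℝ) + 2)) ∧
    (∀ (α N : ℕ) (A : DynNet.Protocol), 1 ≤ α → 2 * α ≤ N →
      (∀ (σ : ℕ → DynNet.Update) (t : ℕ), DynNet.ArboricityPreserving α N σ t →
        ∃ d : ℕ, DynNet.Maintains A d σ t) →
      ∃ (σ : ℕ → DynNet.Update) (t : ℕ), DynNet.ArboricityPreserving α N σ t ∧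
        ∃ v ∈ (DynNet.graphAt σ t).verts, α ≤ (DynNet.memAt A σ t v).size) := by
  constructor
  -- Both constants are dictated by the logarithmic bound; the other parts hold with smaller ones.
  · refine ⟨32, 48, fun α hα Δ hΔ => ⟨DynNet.peeling (4 * α) Δ, fun N σ t hσ => ?_⟩⟩
    have hD : 16 * α ≤ Δ := by omega
    refine ⟨DynNet.maintains_peeling hα hD hσ, fun i hi k v hv => ?_, fun i hi k v hv => ?_,
      fun δ o hδ ho => ?_, ?_⟩
    · exact (DynNet.memoryAtMost_peeling hα hD hσ i hi k v hv).trans (by omega)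
    · obtain ⟨h1, h2⟩ := DynNet.wordsAtMost_peeling hα hD hσ i hi k v hv
      have hb : 2 * Nat.log 2 (N + 2) ≤ 48 * Nat.log 2 (N + 2) :=
        Nat.mul_le_mul_right _ (by norm_num)
      exact ⟨⟨fun w hw => (h1.1 w hw).trans hb, fun x hx => (h1.2 x hx).trans hb⟩,
        fun w => (h2 w).trans hb⟩
    · obtain ⟨h1, h2⟩ := DynNet.totals_le hα hD (by omega) hσ ho
      exact ⟨h1.trans (by omega), h2.trans (by omega)⟩
    · exact_mod_cast DynNet.totals_le_log hα hΔ hσ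
  · intro α N A hα hN hA
    obtain ⟨σ, t, hσ, hG⟩ := DynNet.exists_sequence_completeNetwork hN
    obtain ⟨d, hd⟩ := hA σ t hσ
    have ho := (hd.2 t le_rfl).1
    rw [hG] at ho
    obtain ⟨v, hv, hle⟩ := DynNet.exists_le_card_out hα ho
    exact ⟨σ, t, hσ, v, hG ▸ hv, hle.trans (Nat.le_add_right _ _)⟩
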